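/- **Setting.** Let $\Phi,F,G\in\mathbb Z[X,Y]$ with $\deg_Y\Phi>0$, $\deg_Y F>0$, $\deg_Y G>0$. Let $\varphi$ be a real function with $\varphi'(x)=\Phi(x,\varphi(x))$ on its domain, let $\alpha<\beta$ be real numbers such that $[\alpha,\beta]$ is contained in the domain of $\varphi$, and put $f(x)=F(x,\varphi(x))$, $g(x)=G(x,\varphi(x))$. Assume that $f$ is not identically zero on $(\alpha,\beta)$. **Subresultants.** Put $\widetilde F=\frac{\partial F}{\partial X}+\frac{\partial F}{\partial Y}\Phi$, $P=\widetilde F G$ and $Q=F$, regarded as polynomials in $Y$ over $\mathbb Z[X]$, of degrees $p>q$. For $0\le j\le q$ let $\mathrm{SRes}_j=\mathrm{SRes}_j(P,Q)$ be the $j$-th signed subresultant polynomial, i.e. the polynomial determinant of the Sylvester–Habicht matrix with rows $Y^{q-j-1}P,\dots,YP,P,Q,YQ,\dots,Y^{p-j-1}Q$: it equals $\sum_{k=0}^{j}\det(M_{j,k})\,Y^k$, where $M_{j,k}$ is the square matrix formed by the columns of coefficients of $Y^{p+q-j-1},Y^{p+q-j-2},\dots,Y^{j+1}$ followed by the column of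 coefficients of $Y^k$. Put $\mathrm{SRes}_{-1}=0$. Let $R_{-1}=P$, $R_0=Q$ and, as long as $R_i\neq0$ ($i\ge 0$), let $n_{i+1}=\deg_Y R_i$ and $R_{i+1}=\mathrm{SRes}_{n_{i+1}-1}$. Let $N=\max\{i\ge0\mid R_i\ne0\}$. For $-1\le i\le N$ let $\tau_i\in\mathbb Z[X]$ be the leading coefficient of $R_i$ in $Y$, and for $1\le i\le N+1$ let $\rho_i\in\mathbb Z[X]$ be the coefficient of $Y^{n_i}$ in $\mathrm{SRes}_{n_i}$. **Signs.** Let $\delta=p-q+1$ and $\varepsilon=(-1)^{\delta(\delta+1)/2}$; this is the sign for which $\varepsilon\,\tau_0^{\delta}R_{-1}=C_0R_0+R_1$ for some $C_0\in\mathbb Z[X,Y]$. For an open interval $I$ that contains no root of $\tau_0,\dots,\tau_N,\rho_1,\dots,\rho_{N+1}$, write $\mathrm{sg}_I(\theta)$ for the constant sign on $I$ of a continuous function $\theta$ without zeros in $I$, and put $\sigma_{I,0}=1$, $\sigma_{I,1}=\varepsilon\,\mathrm{sg}_I(\tau_0)^{\delta}$, $\sigma_{I,i+2}=\mathrm{sg}_I(\rho_{i+2}\tau_{i+1}\rho_{i+1}\tau_i)\,\sigma_{I,i}$.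 Let $\mathbf p_I=(p_{I,0},\dots,p_{I,N})$ with $p_{I,i}(x)=\sigma_{I,i}R_i(x,\varphi(x))$. Write $v(\mathbf p_I,c^+)$, respectively $v(\mathbf p_I,c^-)$, for the number of sign variations, after removal of zeros, of the tuple of signs that the $p_{I,i}$ take immediately to the right, respectively left, of $c$ (the sign being $0$ for a function that is identically zero). **Theorem.** The function $f$ has finitely many zeros in $(\alpha,\beta)$, and the polynomials $\tau_i$ ($-1\le i\le N$), $\rho_i$ ($1\le i\le N+1$) have finitely many roots in $(\alpha,\beta)$. If $\alpha_1<\dots<\alpha_k$ are all these roots, $\alpha_0=\alpha$, $\alpha_{k+1}=\beta$ and $I_j=(\alpha_j,\alpha_{j+1})$ for $0\le j\le k$, then $$\mathrm{TaQ}(f,g;\alpha,\beta):=\#\{x\in(\alpha,\beta)\mid f(x)=0,\ g(x)>0\}-\#\{x\in(\alpha,\beta)\mid f(x)=0,\ g(x)<0\}$$ $$=\#\{1\le j\le k\mid f(\alpha_j)=0,\ g(\alpha_j)>0\}-\#\{1\le j\le k\mid f(\alpha_j)=0,\ g(\alpha_j)<0\}+\sum_{j=0}^{k}\bigl(v(\mathbf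 p_{I_j},\alpha_j^+)-v(\mathbf p_{I_j},\alpha_{j+1}^-)\bigr).$$ -/

import Mathlib

open Polynomial Set Filter Topology
open scoped Polynomial.Bivariate

namespace PfaffianSturm

noncomputable section

/-! Bivariate integer polynomials are elements of `ℤ[X][Y]`: the outer variable is `Y`, so that
`natDegree` is the degree in `Y` and the coefficients are polynomials in `X`. -/

/-- The function `x ↦ F(x, φ(x))`. -/
def pfaff (φ : ℝ → ℝ) (F : ℤ[X][Y]) (x : ℝ) : ℝ :=
  aevalAeval x (φ x) F

/-- The partial derivative `∂F/∂X`. -/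
def partialX (F : ℤ[X][Y]) : ℤ[X][Y] :=
  F.sum fun n c => monomial n (derivative c)

/-- `∂F/∂X + (∂F/∂Y) Φ`, the polynomial that defines the derivative of `x ↦ F(x, φ(x))` when
`φ' = Φ(x, φ)`. -/
def tildePoly (Φ F : ℤ[X][Y]) : ℤ[X][Y] :=
  partialX F + derivative F * Φ

section Subresultants

variable {A : Type*} [CommRing A]

/-- Row `r` of the `j`-th Sylvester-Habicht matrix of `P` and `Q` (of degrees `p > q`, `j ≤ q`),
as a polynomial: the rows are `Y^(q-j-1) P, …, Y P, P, Q, Y Q, …, Y^(p-j-1) Q`. -/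
def habichtRow (P Q : A[X]) (j r : ℕ) : A[X] :=
  if r < Q.natDegree - j then X ^ (Q.natDegree - j - 1 - r) * P
  else X ^ (r - (Q.natDegree - j)) * Q

/-- The square matrix formed by the first `p + q - 2j - 1` columns of the `j`-th Sylvester-Habicht
matrix (the coefficients of `Y^(p+q-j-1), Y^(p+q-j-2), …, Y^(j+1)`) and, as its last column, the
column of the coefficients of `Y^k`. -/
def habichtMatrix (P Q : A[X]) (j k : ℕ) :
    Matrix (Fin (P.natDegree + Q.natDegree - 2 * j))
      (Fin (P.natDegree + Q.natDegree - 2 * j)) A :=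
  Matrix.of fun r c =>
    if c.val + 1 < P.natDegree + Q.natDegree - 2 * j then
      (habichtRow P Q j r).coeff (P.natDegree + Q.natDegree - j - 1 - c)
    else (habichtRow P Q j r).coeff k

/-- The `j`-th (signed) subresultant polynomial of `P` and `Q`, for `j ≤ deg Q < deg P`: the
polynomial determinant of the `j`-th Sylvester-Habicht matrix. -/
def subres (P Q : A[X]) (j : ℕ) : A[X] :=
  ∑ k ∈ Finset.range (j + 1), monomial k (habichtMatrix P Q j k).det

/-- The sequence `R_0 = Q`, `R_{i+1} = SRes_{deg R_i - 1}(P, Q)` as long as `R_i ≠ 0`, where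
`SRes_{-1} = 0`. It is continued by zeros. -/
def seqR (P Q : A[X]) : ℕ → A[X]
  | 0 => Q
  | i + 1 => if (seqR P Q i).natDegree = 0 then 0 else subres P Q ((seqR P Q i).natDegree - 1)

/-- `N = max {i ≥ 0 | R_i ≠ 0}`. -/
def lastIndex (P Q : A[X]) : ℕ :=
  sSup {i | seqR P Q i ≠ 0}

/-- `τ_i`, the leading coefficient of `R_i`, for `0 ≤ i ≤ N`. -/
def tau (P Q : A[X]) (i : ℕ) : A :=
  (seqR P Q i).leadingCoeff

/-- `ρ_i`, for `1 ≤ i ≤ N + 1`: the `n_i`-th subresultant coefficient of `P` and `Q`, that is, the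
coefficient of degree `n_i` of the `n_i`-th subresultant polynomial, where `n_i = deg R_{i-1}`. -/
def rho (P Q : A[X]) (i : ℕ) : A :=
  (subres P Q (seqR P Q (i - 1)).natDegree).coeff (seqR P Q (i - 1)).natDegree

end Subresultants

open Classical in
/-- The sign that `θ` takes near the filter `l`: `1` if `θ` is eventually positive, `-1` if `θ` is
eventually negative, `0` otherwise. -/
def eventualSign (l : Filter ℝ) (θ : ℝ → ℝ) : SignType :=
  if ∀ᶠ x in l, 0 < θ x then 1 else if ∀ᶠ x in l, θ x < 0 then -1 else 0

open Classical in
/-- The constant sign of `θ` in the open interval `(a, b)`, for a continuous `θ` without zeros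
there. -/
def signOn (a b : ℝ) (θ : ℝ → ℝ) : SignType :=
  if ∀ x ∈ Ioo a b, 0 < θ x then 1 else if ∀ x ∈ Ioo a b, θ x < 0 then -1 else 0

/-- The number of sign variations of a list of signs: remove the zeros, then count the pairs of
consecutive entries of opposite signs. -/
def signVar (l : List SignType) : ℕ :=
  ((l.filter (· ≠ 0)).zip (l.filter (· ≠ 0)).tail).countP fun s => s.1 * s.2 = -1

/-- `v((θ_0, …, θ_N), c⁺)`. -/
def varRight (N : ℕ) (θ : ℕ → ℝ → ℝ) (c : ℝ) : ℕ :=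
  signVar ((List.range (N + 1)).map fun i => eventualSign (𝓝[>] c) (θ i))

/-- `v((θ_0, …, θ_N), c⁻)`. -/
def varLeft (N : ℕ) (θ : ℕ → ℝ → ℝ) (c : ℝ) : ℕ :=
  signVar ((List.range (N + 1)).map fun i => eventualSign (𝓝[<] c) (θ i))

/-- The signs `σ_{I,i}` for `I = (a, b)`, with `δ = deg P - deg Q + 1` and
`ε = (-1)^(δ(δ+1)/2)`. This `ε` is the sign for which `ε τ_0^δ P = C_0 Q + R_1` for some
polynomial `C_0`. -/
def sigma (P Q : ℤ[X][Y]) (a b : ℝ) : ℕ → SignType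
  | 0 => 1
  | 1 =>
    (-1) ^ ((P.natDegree - Q.natDegree + 1) * (P.natDegree - Q.natDegree + 1 + 1) / 2) *
      signOn a b (fun x => aeval x (tau P Q 0)) ^ (P.natDegree - Q.natDegree + 1)
  | i + 2 =>
    signOn a b (fun x =>
      aeval x (rho P Q (i + 2) * tau P Q (i + 1) * rho P Q (i + 1) * tau P Q i)) *
      sigma P Q a b i

/-- The functions `p_{I,i}(x) = σ_{I,i} R_i(x, φ(x))` for `I = (a, b)`. -/
def seqP (φ : ℝ → ℝ) (P Q : ℤ[X][Y]) (a b : ℝ) (i : ℕ) (x : ℝ) : ℝ :=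
  (sigma P Q a b i : ℝ) * pfaff φ (seqR P Q i) x

/-- The real roots of `τ_{-1} = lc(P)`, of `τ_0, …, τ_N` and of `ρ_1, …, ρ_{N+1}`. -/
def criticalRoots (P Q : ℤ[X][Y]) : Set ℝ :=
  {x | aeval x P.leadingCoeff = 0 ∨
    (∃ i ≤ lastIndex P Q, aeval x (tau P Q i) = 0) ∨
    ∃ i, 1 ≤ i ∧ i ≤ lastIndex P Q + 1 ∧ aeval x (rho P Q i) = 0}

/-- The Tarski query of `f` for `g` in `[α, β]`. -/
def tarskiQuery (f g : ℝ → ℝ) (α β : ℝ) : ℤ :=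
  ({x | x ∈ Ioo α β ∧ f x = 0 ∧ 0 < g x}.ncard : ℤ) -
    ({x | x ∈ Ioo α β ∧ f x = 0 ∧ g x < 0}.ncard : ℤ)

end

end PfaffianSturm

/-!
Write `R_i` for the sequence `seqR P Q` with `P = F̃ G` and `Q = F`, where `F̃ = tildePoly Φ F` is
the polynomial with `f' = F̃(x, φ(x))`. On an interval without critical roots, the functions
`p_i = σ_i R_i(x, φ(x))` behave like a Sturm chain that starts with `f` and, up to a positive factor
and modulo `f`, `f' g`. The theorem follows by adding up these intervals.

*Algebra.* Over a field, one division `P + R = T Q` turns the subresultants of `P` and `Q` into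
those of `Q` and `R`: reversing the rows of the Sylvester-Habicht matrix, replacing `P` by `-R` by
row operations and expanding along the columns that have become triangular gives the matrix of `Q`
and `R`, up to a factor that depends only on the degrees and the leading coefficient
(`det_habichtMatrix_division`). Induction along the Euclidean algorithm then shows that the `ρ_i` do
not vanish and that `R_{i+1}` divides `ρ_{i+2} τ_{i+1} R_i + ρ_{i+1} τ_i R_{i+2}`
(`seqR_structure`). The relation holds over `ℤ[X]` after multiplication by a power of `τ_{i+1}`, by
pseudo-division; this power has no zero on the intervals in question.

*Analysis.* A function `H(x, φ(x))` whose derivatives all vanish at one point is zero: since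
`ℤ[X][Y]` is noetherian, the derivatives satisfy a linear system of differential equations
(`pfaff_eq_zero_of_flat`). So every function that is not identically zero has zeros of finite order
only, hence finitely many of them, and a logarithmic derivative with a simple pole of positive
residue at each zero (`exists_tendsto_logDeriv`).

*Jumps.* All terms of the chain may vanish together at a point `c`, and some of them identically.
The relations of the chain express each `p_i` as a continuous multiple `h_i` of the last term
`p_N`, and the `h_i` form a chain at `c` whose adjacent terms have no common zero. So the number of
variations jumps at `c` only if `h_0(c) = 0`, which happens exactly if `f(c) = 0 ≠ g(c)`, and the
sign of `p_0 p_1` near `c` is then that of `g f' / f` (`IsSturmChainAt.exists_jump`).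
-/

namespace PfaffianSturm

noncomputable section

/-! ### Polynomial determinants -/

section PolynomialDeterminant

variable {A : Type*} [CommRing A]

lemma sign_revPerm (n : ℕ) :
    Equiv.Perm.sign (Fin.revPerm : Equiv.Perm (Fin n)) = (-1) ^ n.choose 2 := by
  rw [Equiv.Perm.sign_eq_prod_prod_Ioi]
  have h : ∀ i : Fin n, (∏ j > i, if Fin.revPerm i < Fin.revPerm j then (1 : ℤˣ) else -1) =
      (-1) ^ (n - 1 - (i : ℕ)) := by
    intro i
    rw [← Fin.card_Ioi, ← Finset.prod_const]
    refine Finset.prod_congr rfl fun j hj => ?_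
    rw [if_neg]
    have := Finset.mem_Ioi.1 hj
    simp only [Fin.revPerm_apply, Fin.rev_lt_rev, not_lt]
    exact this.le
  rw [Finset.prod_congr rfl fun i _ => h i, Fin.prod_univ_eq_prod_range
    (fun i => (-1 : ℤˣ) ^ (n - 1 - i)) n, Finset.prod_range_reflect (fun i => (-1 : ℤˣ) ^ i),
    Finset.prod_pow_eq_pow_sum, Finset.sum_range_id, Nat.choose_two_right]

lemma neg_one_pow_choose_two_add (R : Type*) [Ring R] (d u : ℕ) :
    (-1 : R) ^ (d + 2 * u).choose 2 = (-1) ^ d.choose 2 * (-1) ^ u := by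
  induction u with
  | zero => simp
  | succ u ih =>
    have : (d + 2 * (u + 1)).choose 2 = (d + 2 * u).choose 2 + 2 * (d + 2 * u) + 1 := by
      have : d + 2 * (u + 1) = d + 2 * u + 1 + 1 := by ring
      rw [this, Nat.choose_succ_succ' _ 1, Nat.choose_succ_succ' _ 1]
      simp
      ring
    rw [this, pow_succ, pow_add, ih, pow_mul]
    simp [pow_succ]

/-- The square matrix of the coefficients of the polynomials `w 0, …, w (n - 1)` in the degrees
`x 0, …, x (n - 1)`. -/
def coeffMatrix (n : ℕ) (w : ℕ → A[X]) (x : ℕ → ℕ) : Matrix (Fin n) (Fin n) A :=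
  Matrix.of fun r c => (w r).coeff (x c)

/-- The sequence `Y^(u-1) P, …, Y P, P, Q, Y Q, Y^2 Q, …`. -/
def shiftRow (P Q : A[X]) (u r : ℕ) : A[X] :=
  if r < u then X ^ (u - 1 - r) * P else X ^ (r - u) * Q

/-- The degrees of the columns of a polynomial determinant: `e, e - 1, …`, and `k` in the last of
the `n` places. -/
def columnDegree (n e k c : ℕ) : ℕ :=
  if c + 1 < n then e - c else k

lemma habichtMatrix_eq (P Q : A[X]) (j k : ℕ) :
    habichtMatrix P Q j k = coeffMatrix (P.natDegree + Q.natDegree - 2 * j)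
      (shiftRow P Q (Q.natDegree - j))
      (columnDegree (P.natDegree + Q.natDegree - 2 * j)
        (P.natDegree + Q.natDegree - j - 1) k) := by
  ext r c
  simp only [habichtMatrix, coeffMatrix, Matrix.of_apply, columnDegree, habichtRow, shiftRow]
  split_ifs <;> rfl

/-- Reversing the order of the rows exchanges the roles of the two polynomials. -/
lemma det_coeffMatrix_reverse (P Q : A[X]) (u v : ℕ) (x : ℕ → ℕ) :
    (coeffMatrix (u + v) (shiftRow P Q u) x).det =
      (-1) ^ (u + v).choose 2 * (coeffMatrix (u + v) (shiftRow Q P v) x).det := by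
  have h : coeffMatrix (u + v) (shiftRow P Q u) x =
      (coeffMatrix (u + v) (shiftRow Q P v) x).submatrix Fin.revPerm id := by
    ext r c
    have hr := r.isLt
    simp only [coeffMatrix, Matrix.of_apply, Matrix.submatrix_apply, id, Fin.revPerm_apply,
      Fin.val_rev, shiftRow]
    split_ifs with h1 h2 h2
    · omega
    · congr 3; omega
    · congr 3; omega
    · omega
  rw [h, Matrix.det_permute, sign_revPerm]
  simp

/-- Adding to the rows `P, Y P, …` multiples of the rows `Y^(v-1) Q, …, Q` above them does not
change the determinant. -/
lemma det_coeffMatrix_add_mul (P Q T : A[X]) (n v : ℕ) (x : ℕ → ℕ)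
    (h : T.natDegree + n ≤ 2 * v) :
    (coeffMatrix n (shiftRow Q (P + T * Q) v) x).det =
      (coeffMatrix n (shiftRow Q P v) x).det := by
  let L : Matrix (Fin n) (Fin n) A := Matrix.of fun r s =>
    if r = s then 1 else if (s : ℕ) < v ∧ v ≤ (r : ℕ) then
      (X ^ ((r : ℕ) - v) * T).coeff (v - 1 - s) else 0
  have hL : L.det = 1 := by
    rw [Matrix.det_of_isLowerTriangular]
    · exact Finset.prod_eq_one fun i _ => by simp [L]
    · intro r s hrs
      have hrs' : (r : ℕ) < s := hrs
      simp only [L, Matrix.of_apply]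
      rw [if_neg (by rintro rfl; omega), if_neg (by omega)]
  have hM : coeffMatrix n (shiftRow Q (P + T * Q) v) x =
      L * coeffMatrix n (shiftRow Q P v) x := by
    ext r c
    rw [Matrix.mul_apply]
    have hr := r.isLt
    by_cases hrv : (r : ℕ) < v
    · rw [Finset.sum_eq_single r]
      · simp [L, coeffMatrix, shiftRow, hrv]
      · intro s _ hs
        simp only [L, Matrix.of_apply]
        rw [if_neg (Ne.symm hs), if_neg (by omega), zero_mul]
      · simp
    · have hdeg : (X ^ ((r : ℕ) - v) * T).natDegree < v := by
        have h1 := natDegree_mul_le (p := (X : A[X]) ^ ((r : ℕ) - v)) (q := T)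
        have h2 := natDegree_X_pow_le (R := A) ((r : ℕ) - v)
        omega
      set f : ℕ → A := fun s => if s < v then (X ^ ((r : ℕ) - v) * T).coeff (v - 1 - s) *
        (X ^ (v - 1 - s) * Q).coeff (x c) else 0 with hf
      have hsplit : ∀ s : Fin n, L r s * coeffMatrix n (shiftRow Q P v) x s c =
          (if s = r then coeffMatrix n (shiftRow Q P v) x r c else 0) +
          f s := by
        intro s
        by_cases hs : s = r
        · subst hs
          simp [L, hf, hrv]
        · simp only [L, Matrix.of_apply, Ne.symm hs, hs, if_false, zero_add]
          by_cases hsv : (s : ℕ) < v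
          · simp [hf, hsv, not_lt.1 hrv, coeffMatrix, shiftRow]
          · simp [hf, hsv]
      rw [Finset.sum_congr rfl fun s _ => hsplit s, Finset.sum_add_distrib,
        Finset.sum_ite_eq' Finset.univ r, if_pos (Finset.mem_univ _),
        Fin.sum_univ_eq_sum_range f n]
      have hsum : ∑ s ∈ Finset.range n, f s =
          (X ^ ((r : ℕ) - v) * T * Q).coeff (x c) := by
        rw [hf, ← Finset.sum_filter]
        have : (Finset.range n).filter (· < v) = Finset.range v := by
          ext s; simp; omega
        rw [this]
        refine (Finset.sum_range_reflect
          (fun s => (X ^ ((r : ℕ) - v) * T).coeff s * (X ^ s * Q).coeff (x c)) v).trans ?_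
        conv_rhs => rw [as_sum_range' (X ^ ((r : ℕ) - v) * T) v hdeg, Finset.sum_mul,
          finsetSum_coeff]
        refine Finset.sum_congr rfl fun s _ => ?_
        rw [← C_mul_X_pow_eq_monomial, mul_assoc, coeff_C_mul]
      rw [hsum]
      simp only [coeffMatrix, Matrix.of_apply, shiftRow, hrv, if_false]
      rw [← coeff_add, mul_add, mul_assoc]
  rw [hM, Matrix.det_mul, hL, one_mul]

/-- Expansion of the determinant along `t` initial columns that are triangular with the constant
diagonal `b`. -/
lemma det_coeffMatrix_peel (b : A) (t m : ℕ) (w : ℕ → A[X]) (x : ℕ → ℕ)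
    (hdiag : ∀ c < t, (w c).coeff (x c) = b)
    (hlow : ∀ c < t, ∀ r, c < r → r < t + m → (w r).coeff (x c) = 0) :
    (coeffMatrix (t + m) w x).det =
      b ^ t * (coeffMatrix m (fun r => w (t + r)) (fun c => x (t + c))).det := by
  let T : Matrix (Fin t) (Fin t) A := Matrix.of fun r c => (w r).coeff (x c)
  have hT : T.det = b ^ t := by
    rw [Matrix.det_of_isUpperTriangular]
    · simp [T, hdiag]
    · intro r c hrc
      exact hlow c c.isLt r hrc (by have := r.isLt; omega)
  have hB : (coeffMatrix (t + m) w x).submatrix finSumFinEquiv finSumFinEquiv =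
      Matrix.fromBlocks T (Matrix.of fun (r : Fin t) (c : Fin m) => (w r).coeff (x (t + c))) 0
        (coeffMatrix m (fun r => w (t + r)) (fun c => x (t + c))) := by
    ext r c
    rcases r with r | r <;> rcases c with c | c <;>
      simp [coeffMatrix, T]
    exact hlow c c.isLt _ (by have := c.isLt; omega) (by have := r.isLt; omega)
  rw [← Matrix.det_submatrix_equiv_self finSumFinEquiv, hB, Matrix.det_fromBlocks_zero₂₁, hT]

lemma det_coeffMatrix_neg (Q R : A[X]) (u v : ℕ) (x : ℕ → ℕ) :
    (coeffMatrix (v + u) (shiftRow Q (-R) v) x).det =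
      (-1) ^ u * (coeffMatrix (v + u) (shiftRow Q R v) x).det := by
  have h : coeffMatrix (v + u) (shiftRow Q (-R) v) x =
      Matrix.of fun (r c : Fin (v + u)) => (if (r : ℕ) < v then (1 : A) else -1) *
        coeffMatrix (v + u) (shiftRow Q R v) x r c := by
    ext r c
    simp only [coeffMatrix, shiftRow, Matrix.of_apply]
    split_ifs <;> simp
  rw [h, Matrix.det_mul_column, Fin.prod_univ_add]
  simp

end PolynomialDeterminant

/-! ### The structure theorem for signed subresultants -/

section Structure

variable {K : Type*} [CommRing K]

/-- The effect of one division step on the subresultants. Here `P + R = T Q`, so that `-R` is a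
remainder of `P` modulo `Q`, and `t` columns are expanded. -/
lemma det_habichtMatrix_division {P Q R T : K[X]} (hPQ : Q.natDegree ≤ P.natDegree)
    (hT : T.natDegree + Q.natDegree ≤ P.natDegree) (hdiv : P + R = T * Q)
    (j k t m : ℕ) (hj : j ≤ Q.natDegree) (ht : t + j ≤ P.natDegree)
    (hR : j = Q.natDegree ∨ R.natDegree + t ≤ P.natDegree)
    (hm : t + m = P.natDegree + Q.natDegree - 2 * j) (hm1 : 1 ≤ m) :
    (habichtMatrix P Q j k).det =
      (-1) ^ (P.natDegree - Q.natDegree).choose 2 * Q.leadingCoeff ^ t *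
        (coeffMatrix m (shiftRow Q R (P.natDegree - j - t))
          (columnDegree m (P.natDegree + Q.natDegree - j - 1 - t) k)).det := by
  rw [habichtMatrix_eq]
  set p := P.natDegree with hp
  set q := Q.natDegree with hq
  clear_value p q
  obtain ⟨u, rfl⟩ : ∃ u, q = j + u := ⟨q - j, by omega⟩
  obtain ⟨d, hd⟩ : ∃ d, p = j + u + d := ⟨p - (j + u), by omega⟩
  have e1 : p + (j + u) - 2 * j = u + (u + d) := by omega
  have hP : P = -R + T * Q := by rw [← hdiv]; ring
  rw [e1, show j + u - j = u by omega, det_coeffMatrix_reverse]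
  conv_lhs => rw [hP]
  rw [det_coeffMatrix_add_mul _ _ _ _ _ _ (by omega), show u + (u + d) = (u + d) + u by ring,
    det_coeffMatrix_neg, show (u + d) + u = t + m by omega, det_coeffMatrix_peel Q.leadingCoeff]
  · have e2 : (fun r => shiftRow Q R (u + d) (t + r)) = shiftRow Q R (p - j - t) := by
      funext r
      simp only [shiftRow]
      split_ifs
      · congr 2; omega
      · omega
      · omega
      · congr 2; omega
    have e3 : (fun c => columnDegree (t + m) (p + (j + u) - j - 1) k (t + c)) =
        columnDegree m (p + (j + u) - j - 1 - t) k := by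
      funext c
      simp only [columnDegree]
      split_ifs <;> omega
    rw [e2, e3, show p - (j + u) = d by omega, show t + m = d + 2 * u by omega,
      neg_one_pow_choose_two_add]
    have : (-1 : K) ^ u * (-1) ^ u = 1 := by rw [← mul_pow]; simp
    linear_combination ((-1) ^ d.choose 2 * (Q.leadingCoeff ^ t * (coeffMatrix m
      (shiftRow Q R (p - j - t)) (columnDegree m (p + (j + u) - j - 1 - t) k)).det)) * this
  · intro c hc
    have h1 : c < u + d := by omega
    simp only [shiftRow, columnDegree, h1, if_true]
    rw [if_pos (by omega), show p + (j + u) - j - 1 - c = Q.natDegree + (u + d - 1 - c) by omega,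
      mul_comm, coeff_mul_X_pow]
    rfl
  · intro c hc r hcr hr
    simp only [columnDegree]
    rw [if_pos (by omega)]
    apply coeff_eq_zero_of_natDegree_lt
    simp only [shiftRow]
    split_ifs with h1
    · have h2 := natDegree_mul_le (p := (X : K[X]) ^ (u + d - 1 - r)) (q := Q)
      have h3 := natDegree_X_pow_le (R := K) (u + d - 1 - r)
      omega
    · have h2 := natDegree_mul_le (p := (X : K[X]) ^ (r - (u + d))) (q := R)
      have h3 := natDegree_X_pow_le (R := K) (r - (u + d))
      omega

lemma coeff_subres (P Q : K[X]) (j k : ℕ) :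
    (subres P Q j).coeff k = if k ≤ j then (habichtMatrix P Q j k).det else 0 := by
  simp [subres, coeff_monomial]

lemma natDegree_subres_le (P Q : K[X]) (j : ℕ) : (subres P Q j).natDegree ≤ j := by
  rw [natDegree_le_iff_coeff_eq_zero]
  intro k hk
  rw [coeff_subres, if_neg (by omega)]

lemma natDegree_seqR_succ_lt {P Q : K[X]} {i : ℕ} (h : seqR P Q (i + 1) ≠ 0) :
    (seqR P Q (i + 1)).natDegree < (seqR P Q i).natDegree := by
  have h0 : (seqR P Q i).natDegree ≠ 0 := fun h0 => h (by simp [seqR, h0])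
  have : seqR P Q (i + 1) = subres P Q ((seqR P Q i).natDegree - 1) := by simp [seqR, h0]
  rw [this]
  have := natDegree_subres_le P Q ((seqR P Q i).natDegree - 1)
  omega

lemma seqR_succ_eq_zero {P Q : K[X]} {i : ℕ} (h : seqR P Q i = 0) : seqR P Q (i + 1) = 0 := by
  simp [seqR, h]

lemma seqR_eq_zero_of_le {P Q : K[X]} {i j : ℕ} (hij : i ≤ j) (h : seqR P Q i = 0) :
    seqR P Q j = 0 := by
  induction j, hij using Nat.le_induction with
  | base => exact h
  | succ j _ ih => exact seqR_succ_eq_zero ih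

lemma seqR_ne_zero_of_le {P Q : K[X]} {i j : ℕ} (hij : i ≤ j) (h : seqR P Q j ≠ 0) :
    seqR P Q i ≠ 0 :=
  fun h0 => h (seqR_eq_zero_of_le hij h0)

lemma natDegree_seqR_add_le {P Q : K[X]} {i : ℕ} (h : seqR P Q i ≠ 0) :
    (seqR P Q i).natDegree + i ≤ Q.natDegree := by
  induction i with
  | zero => simp [seqR]
  | succ i ih =>
    have h1 := natDegree_seqR_succ_lt h
    have h2 := ih (seqR_ne_zero_of_le (Nat.le_succ i) h)
    omega

lemma bddAbove_seqR_ne_zero (P Q : K[X]) : BddAbove {i | seqR P Q i ≠ 0} :=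
  ⟨Q.natDegree, fun i hi => by have := natDegree_seqR_add_le hi; omega⟩

lemma seqR_ne_zero_iff {P Q : K[X]} (hQ : Q ≠ 0) {i : ℕ} :
    seqR P Q i ≠ 0 ↔ i ≤ lastIndex P Q := by
  constructor
  · exact fun h => le_csSup (bddAbove_seqR_ne_zero P Q) h
  · intro h
    exact seqR_ne_zero_of_le h (Nat.sSup_mem ⟨0, hQ⟩ (bddAbove_seqR_ne_zero P Q))

section Division

variable {P Q R T : K[X]} (hPQ : Q.natDegree < P.natDegree)
  (hT : T.natDegree + Q.natDegree ≤ P.natDegree) (hdiv : P + R = T * Q)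

include hPQ hT hdiv

/-- The case `j = q`, in which only rows that are multiples of `Q` occur. -/
lemma rho_one_eq : rho P Q 1 =
    (-1) ^ (P.natDegree - Q.natDegree).choose 2 *
      Q.leadingCoeff ^ (P.natDegree - Q.natDegree) := by
  have h : rho P Q 1 = (subres P Q Q.natDegree).coeff Q.natDegree := rfl
  rw [h, coeff_subres, if_pos le_rfl, det_habichtMatrix_division hPQ.le hT hdiv Q.natDegree
    Q.natDegree (P.natDegree - Q.natDegree - 1) 1 le_rfl (by omega) (Or.inl rfl) (by omega)
    le_rfl, Matrix.det_fin_one]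
  have e1 : shiftRow Q R (P.natDegree - Q.natDegree - (P.natDegree - Q.natDegree - 1)) 0 = Q := by
    simp only [shiftRow]
    rw [if_pos (by omega)]
    have : P.natDegree - Q.natDegree - (P.natDegree - Q.natDegree - 1) - 1 - 0 = 0 := by omega
    rw [this, pow_zero, one_mul]
  have e2 : P.natDegree - Q.natDegree = P.natDegree - Q.natDegree - 1 + 1 := by omega
  simp only [coeffMatrix, Matrix.of_apply, Fin.val_zero, e1]
  conv_rhs => rw [e2, pow_succ]
  simp [columnDegree, mul_assoc, ← e2]

/-- The case `j = q - 1`: after the expansion only the row of `R` is left. -/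
lemma subres_pred_eq (hR : R.natDegree < Q.natDegree) :
    subres P Q (Q.natDegree - 1) = C ((-1) ^ (P.natDegree - Q.natDegree).choose 2 *
      Q.leadingCoeff ^ (P.natDegree - Q.natDegree + 1)) * R := by
  ext k
  rw [coeff_subres, coeff_C_mul]
  split_ifs with hk
  · rw [det_habichtMatrix_division hPQ.le hT hdiv (Q.natDegree - 1) k
      (P.natDegree - Q.natDegree + 1) 1 (by omega) (by omega) (Or.inr (by omega)) (by omega)
      le_rfl, Matrix.det_fin_one]
    have e1 : P.natDegree - (Q.natDegree - 1) - (P.natDegree - Q.natDegree + 1) = 0 := by omega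
    simp [coeffMatrix, e1, shiftRow, columnDegree]
  · rw [coeff_eq_zero_of_natDegree_lt (by omega), mul_zero]

/-- The factor does not depend on `j`. -/
lemma subres_division (hR : R.natDegree < Q.natDegree) {j : ℕ} (hj : j ≤ R.natDegree) :
    subres P Q j = C ((-1) ^ (P.natDegree - Q.natDegree).choose 2 *
      Q.leadingCoeff ^ (P.natDegree - R.natDegree)) * subres Q R j := by
  ext k
  rw [coeff_subres, coeff_C_mul, coeff_subres]
  split_ifs with hk
  · rw [det_habichtMatrix_division hPQ.le hT hdiv j k
      (P.natDegree - R.natDegree) (Q.natDegree + R.natDegree - 2 * j) (by omega) (by omega)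
      (Or.inr (by omega)) (by omega) (by omega), habichtMatrix_eq,
      show P.natDegree - j - (P.natDegree - R.natDegree) = R.natDegree - j by omega,
      show P.natDegree + Q.natDegree - j - 1 - (P.natDegree - R.natDegree) =
        Q.natDegree + R.natDegree - j - 1 by omega]
  · simp

end Division

end Structure

section FieldStructure

variable {K : Type*} [Field K]

lemma seqR_one {P Q : K[X]} (hq : Q.natDegree ≠ 0) :
    seqR P Q 1 = subres P Q (Q.natDegree - 1) := by
  simp [seqR, hq]

/-- If `-R ≠ 0` is the remainder of `P` modulo `Q`, then the sequence of `P` and `Q` is, up to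
constant factors and a shift, the sequence of `Q` and `R`. The factor `κ` is common to all
subresultants of index at most `deg R`, and only the first term of the sequence has another one. -/
lemma exists_seqR_shift {P Q R T : K[X]} (hPQ : Q.natDegree < P.natDegree)
    (hT : T.natDegree + Q.natDegree ≤ P.natDegree) (hdiv : P + R = T * Q)
    (hR : R.natDegree < Q.natDegree) :
    ∃ κ : K, κ ≠ 0 ∧ ∃ μ : ℕ → K, (∀ i, μ i ≠ 0) ∧ (∀ i, μ (i + 1) = κ) ∧
      μ 0 = rho P Q 1 * tau P Q 0 ∧
      (∀ i, seqR P Q (i + 1) = C (μ i) * seqR Q R i) ∧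
      (∀ i, rho P Q (i + 2) = κ * rho Q R (i + 1)) ∧
      ∀ i, tau P Q (i + 1) = μ i * tau Q R i := by
  have hQ : Q ≠ 0 := by rintro rfl; simp at hR
  have hb : Q.leadingCoeff ≠ 0 := leadingCoeff_ne_zero.2 hQ
  set κ : K := (-1) ^ (P.natDegree - Q.natDegree).choose 2 *
      Q.leadingCoeff ^ (P.natDegree - R.natDegree) with hκ
  set l : K := (-1) ^ (P.natDegree - Q.natDegree).choose 2 *
      Q.leadingCoeff ^ (P.natDegree - Q.natDegree + 1) with hl
  have hκ0 : κ ≠ 0 := mul_ne_zero (pow_ne_zero _ (by simp)) (pow_ne_zero _ hb)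
  have hl0 : l ≠ 0 := mul_ne_zero (pow_ne_zero _ (by simp)) (pow_ne_zero _ hb)
  let μ : ℕ → K := fun i => if i = 0 then l else κ
  have hμ : ∀ i, μ i ≠ 0 := fun i => by
    simp only [μ]; split_ifs <;> assumption
  have hseq : ∀ i, seqR P Q (i + 1) = C (μ i) * seqR Q R i := by
    intro i
    induction i with
    | zero =>
      have : seqR P Q (0 + 1) = subres P Q (Q.natDegree - 1) := seqR_one (by omega)
      rw [this, subres_pred_eq hPQ hT hdiv hR]
      rfl
    | succ i ih =>
      have hd : (seqR P Q (i + 1)).natDegree = (seqR Q R i).natDegree := by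
        rw [ih, natDegree_C_mul (hμ i)]
      have hle : (seqR Q R i).natDegree ≤ R.natDegree := by
        by_cases h0 : seqR Q R i = 0
        · simp [h0]
        · have := natDegree_seqR_add_le h0
          omega
      change (if (seqR P Q (i + 1)).natDegree = 0 then 0
        else subres P Q ((seqR P Q (i + 1)).natDegree - 1)) = C (μ (i + 1)) *
          (if (seqR Q R i).natDegree = 0 then 0 else subres Q R ((seqR Q R i).natDegree - 1))
      rw [hd]
      split_ifs with h0
      · simp
      · rw [subres_division hPQ hT hdiv hR (by omega)]
        rfl
  refine ⟨κ, hκ0, μ, hμ, fun i => rfl, ?_, hseq, ?_, ?_⟩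
  · rw [rho_one_eq hPQ hT hdiv]
    simp only [μ, hl, tau, seqR, if_true]
    ring
  · intro i
    have hd : (seqR P Q (i + 1)).natDegree = (seqR Q R i).natDegree := by
      rw [hseq, natDegree_C_mul (hμ i)]
    have hle : (seqR Q R i).natDegree ≤ R.natDegree := by
      by_cases h0 : seqR Q R i = 0
      · simp [h0]
      · have := natDegree_seqR_add_le h0
        omega
    change (subres P Q (seqR P Q (i + 1)).natDegree).coeff (seqR P Q (i + 1)).natDegree =
      κ * (subres Q R (seqR Q R i).natDegree).coeff (seqR Q R i).natDegree
    rw [hd, subres_division hPQ hT hdiv hR hle, coeff_C_mul]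
  · intro i
    simp only [tau, hseq, leadingCoeff_mul, leadingCoeff_C]

/-- The data of a division with remainder, with the sign of the remainder changed. -/
lemma exists_neg_remainder {P Q : K[X]} (hQ : Q ≠ 0) (hPQ : Q.natDegree < P.natDegree) :
    ∃ R T : K[X], T.natDegree + Q.natDegree ≤ P.natDegree ∧ P + R = T * Q ∧
      (R ≠ 0 → R.natDegree < Q.natDegree) := by
  refine ⟨-(P % Q), P / Q, ?_, ?_, ?_⟩
  · have h := degree_add_div hQ (degree_lt_degree hPQ).le
    by_cases h0 : P / Q = 0
    · rw [h0, natDegree_zero]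
      omega
    · have hP : P ≠ 0 := by rintro rfl; simp at hPQ
      rw [degree_eq_natDegree hQ, degree_eq_natDegree h0, degree_eq_natDegree hP] at h
      norm_cast at h
      omega
  · have := EuclideanDomain.div_add_mod P Q
    linear_combination -this
  · intro h
    rw [natDegree_neg]
    refine natDegree_lt_natDegree (by simpa using h) (degree_mod_lt P hQ)

lemma seqR_one_eq_zero {P Q T : K[X]} (hPQ : Q.natDegree < P.natDegree)
    (hT : T.natDegree + Q.natDegree ≤ P.natDegree) (hdiv : P + 0 = T * Q) :
    seqR P Q 1 = 0 := by
  by_cases hq : Q.natDegree = 0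
  · simp [seqR, hq]
  · rw [seqR_one hq, subres_pred_eq hPQ hT hdiv (by simp; omega), mul_zero]

/-- The first term of the sequence is the remainder of a multiple of `P` modulo `Q`. -/
lemma dvd_seqR_one_sub {P Q : K[X]} (hQ : Q ≠ 0) (hPQ : Q.natDegree < P.natDegree) :
    Q ∣ seqR P Q 1 - C ((-1) ^ ((P.natDegree - Q.natDegree + 1) *
      (P.natDegree - Q.natDegree + 1 + 1) / 2) *
      Q.leadingCoeff ^ (P.natDegree - Q.natDegree + 1)) * P := by
  obtain ⟨R, T, hT, hdiv, hR⟩ := exists_neg_remainder hQ hPQ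
  have hP : P = T * Q - R := by rw [← hdiv]; ring
  by_cases h0 : R = 0
  · subst h0
    rw [seqR_one_eq_zero hPQ hT hdiv, zero_sub, dvd_neg]
    refine Dvd.dvd.mul_left ?_ _
    rw [hP, sub_zero]
    exact dvd_mul_left _ _
  · have hR' := hR h0
    have h1 : seqR P Q 1 = subres P Q (Q.natDegree - 1) := seqR_one (by omega)
    rw [h1, subres_pred_eq hPQ hT hdiv hR']
    generalize P.natDegree - Q.natDegree = d
    have hs : (-1 : K) ^ ((d + 1) * (d + 1 + 1) / 2) = - (-1) ^ d.choose 2 := by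
      have := neg_one_pow_choose_two_add K d 1
      rw [Nat.choose_two_right] at this
      simp only [mul_one, pow_one, mul_neg] at this
      rw [← this, mul_comm (d + 1)]
      rfl
    rw [hs, hP]
    refine ⟨C ((-1) ^ d.choose 2 * Q.leadingCoeff ^ (d + 1)) * T, ?_⟩
    simp only [neg_mul, C_neg]
    ring

/-- The structure theorem: the coefficients `ρ_i` do not vanish, and consecutive terms of the
sequence are related by division with remainder with explicit factors. By `exists_seqR_shift` the
case of the index `i + 1` for `P` and `Q` is the case of the index `i` for `Q` and the remainder. -/
theorem seqR_structure (i : ℕ) : ∀ {P Q : K[X]}, Q ≠ 0 → Q.natDegree < P.natDegree →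
    (seqR P Q i ≠ 0 → rho P Q (i + 1) ≠ 0) ∧
    (seqR P Q (i + 1) ≠ 0 → seqR P Q (i + 1) ∣
      C (rho P Q (i + 2) * tau P Q (i + 1)) * seqR P Q i +
      C (rho P Q (i + 1) * tau P Q i) * seqR P Q (i + 2)) := by
  induction i with
  | zero =>
    intro P Q hQ hPQ
    obtain ⟨R, T, hT, hdiv, hR⟩ := exists_neg_remainder hQ hPQ
    have hb : Q.leadingCoeff ≠ 0 := leadingCoeff_ne_zero.2 hQ
    constructor
    · intro _
      rw [zero_add, rho_one_eq hPQ hT hdiv]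
      exact mul_ne_zero (pow_ne_zero _ (by simp)) (pow_ne_zero _ hb)
    · intro h
      have h0 : R ≠ 0 := by
        rintro rfl
        exact h (seqR_one_eq_zero hPQ hT hdiv)
      obtain ⟨κ, hκ, μ, hμ, hμ', hμ0, hseq, hrho, htau⟩ :=
        exists_seqR_shift hPQ hT hdiv (hR h0)
      obtain ⟨R', T', hT', hdiv', hR'⟩ := exists_neg_remainder h0 (hR h0)
      have hc : seqR P Q 1 = C (μ 0) * R := hseq 0
      have h2 : seqR Q R 1 = C (rho Q R 1 * tau Q R 0) * R' := by
        by_cases h0' : R' = 0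
        · subst h0'
          rw [seqR_one_eq_zero (hR h0) hT' hdiv', mul_zero]
        · obtain ⟨κ', -, μ', -, -, hμ0', hseq', -, -⟩ :=
            exists_seqR_shift (hR h0) hT' hdiv' (hR' h0')
          rw [← hμ0']
          exact hseq' 0
      have hQ0 : seqR P Q 0 = Q := rfl
      have e1 : rho P Q (0 + 2) = κ * rho Q R 1 := hrho 0
      have e2 : tau P Q (0 + 1) = μ 0 * tau Q R 0 := htau 0
      have e3 : seqR P Q (0 + 2) = C κ * (C (rho Q R 1 * tau Q R 0) * R') := by
        rw [← h2, ← hμ' 0]; exact hseq 1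
      rw [zero_add, hc, hQ0, e3, ← hμ0, e1, e2]
      refine ⟨C (κ * rho Q R 1 * tau Q R 0) * T', ?_⟩
      simp only [C_mul]
      linear_combination C κ * C (rho Q R 1) * C (μ 0) * C (tau Q R 0) * hdiv'
  | succ i ih =>
    intro P Q hQ hPQ
    obtain ⟨R, T, hT, hdiv, hR⟩ := exists_neg_remainder hQ hPQ
    by_cases h0 : R = 0
    · subst h0
      have h1 := seqR_one_eq_zero hPQ hT hdiv
      exact ⟨fun h => absurd (seqR_eq_zero_of_le (by omega) h1) h,
        fun h => absurd (seqR_eq_zero_of_le (by omega) h1) h⟩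
    · obtain ⟨κ, hκ, μ, hμ, hμ', hμ0, hseq, hrho, htau⟩ :=
        exists_seqR_shift hPQ hT hdiv (hR h0)
      obtain ⟨ih1, ih2⟩ := ih h0 (hR h0)
      constructor
      · intro h
        rw [hseq] at h
        rw [show i + 1 + 1 = i + 2 from rfl, hrho]
        exact mul_ne_zero hκ (ih1 (right_ne_zero_of_mul h))
      · intro h
        rw [hseq] at h
        obtain ⟨c, hc⟩ := ih2 (right_ne_zero_of_mul h)
        rw [hseq, show i + 1 + 2 = (i + 1) + 2 from rfl, hrho, htau, hseq,
          show i + 1 + 1 = i + 2 from rfl, hrho, htau, show i + 1 + 2 = (i + 2) + 1 from rfl, hseq,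
          hμ', show i + 2 = (i + 1) + 1 from rfl, hμ']
        refine ⟨C (κ * μ i) * c, ?_⟩
        have hc' := congrArg (fun z => C (κ * κ * μ i) * z) hc
        simp only [C_mul] at hc' ⊢
        linear_combination hc'

end FieldStructure

/-! ### Transfer to integral domains -/

section DomainStructure

variable {A K : Type*} [CommRing A] [CommRing K]

lemma subres_map {f : A →+* K} (hf : Function.Injective f) (P Q : A[X]) (j : ℕ) :
    (subres P Q j).map f = subres (P.map f) (Q.map f) j := by
  ext k
  rw [coeff_map, coeff_subres, coeff_subres]
  split_ifs with hk
  · rw [RingHom.map_det, habichtMatrix_eq, habichtMatrix_eq,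
      natDegree_map_eq_of_injective hf, natDegree_map_eq_of_injective hf]
    congr 1
    ext r c
    simp only [RingHom.mapMatrix_apply, Matrix.map_apply, coeffMatrix, Matrix.of_apply, shiftRow,
      ← coeff_map]
    split_ifs <;> simp
  · simp

lemma seqR_map {f : A →+* K} (hf : Function.Injective f) (P Q : A[X]) (i : ℕ) :
    (seqR P Q i).map f = seqR (P.map f) (Q.map f) i := by
  induction i with
  | zero => rfl
  | succ i ih =>
    change Polynomial.map f (if (seqR P Q i).natDegree = 0 then 0
      else subres P Q ((seqR P Q i).natDegree - 1)) =
      if (seqR (P.map f) (Q.map f) i).natDegree = 0 then 0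
      else subres (P.map f) (Q.map f) ((seqR (P.map f) (Q.map f) i).natDegree - 1)
    rw [← ih, natDegree_map_eq_of_injective hf]
    split_ifs
    · simp
    · exact subres_map hf P Q _

lemma tau_map {f : A →+* K} (hf : Function.Injective f) (P Q : A[X]) (i : ℕ) :
    f (tau P Q i) = tau (P.map f) (Q.map f) i := by
  rw [tau, tau, ← seqR_map hf, leadingCoeff_map_of_injective hf]

lemma rho_map {f : A →+* K} (hf : Function.Injective f) (P Q : A[X]) (i : ℕ) :
    f (rho P Q i) = rho (P.map f) (Q.map f) i := by
  rw [rho, rho, ← seqR_map hf, natDegree_map_eq_of_injective hf, ← subres_map hf, coeff_map]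

/-- Pseudo-division with remainder. -/
lemma exists_pow_leadingCoeff_mul_eq (R : A[X]) (n : ℕ) : ∀ H : A[X],
    H.natDegree < n → ∃ (m : ℕ) (S H' : A[X]), C (R.leadingCoeff ^ m) * H = S * R + H' ∧
      (H' = 0 ∨ H'.natDegree < R.natDegree) := by
  induction n with
  | zero => intro H h; omega
  | succ n ih =>
    intro H hH
    by_cases h : H.natDegree < R.natDegree
    · exact ⟨0, 0, H, by simp, Or.inr h⟩
    · push Not at h
      set H₁ := C R.leadingCoeff * H -
        C H.leadingCoeff * X ^ (H.natDegree - R.natDegree) * R with hH₁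
      have hX : (C H.leadingCoeff * X ^ (H.natDegree - R.natDegree)).natDegree ≤
          H.natDegree - R.natDegree := natDegree_C_mul_X_pow_le _ _
      have hle : H₁.natDegree ≤ H.natDegree := by
        refine (natDegree_sub_le _ _).trans (max_le (natDegree_C_mul_le _ _) ?_)
        refine natDegree_mul_le.trans ?_
        omega
      have hc : H₁.coeff H.natDegree = 0 := by
        rw [hH₁, coeff_sub, coeff_C_mul, mul_assoc, coeff_C_mul]
        rw [coeff_X_pow_mul', if_pos (by omega),
          show H.natDegree - (H.natDegree - R.natDegree) = R.natDegree by omega]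
        simp only [coeff_natDegree]
        ring
      by_cases h0 : H₁ = 0
      · refine ⟨1, C H.leadingCoeff * X ^ (H.natDegree - R.natDegree), 0, ?_, Or.inl rfl⟩
        rw [pow_one, add_zero]
        exact sub_eq_zero.1 h0
      · by_cases hd : H₁.natDegree = H.natDegree
        · rw [← hd] at hc
          exact absurd (leadingCoeff_eq_zero.1 hc) h0
        · obtain ⟨m, S, H', e, he⟩ := ih H₁ (by omega)
          refine ⟨m + 1, S + C (R.leadingCoeff ^ m) *
            (C H.leadingCoeff * X ^ (H.natDegree - R.natDegree)), H', ?_, he⟩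
          rw [hH₁] at e
          rw [pow_succ, C_mul]
          linear_combination e

/-- A divisibility over an extension field holds over the ring itself after multiplication by a
power of the leading coefficient of the divisor. -/
lemma exists_pow_leadingCoeff_mul_eq_of_dvd [IsDomain K] {f : A →+* K}
    (hf : Function.Injective f) {R H : A[X]} (h : R.map f ∣ H.map f) :
    ∃ (m : ℕ) (S : A[X]), C (R.leadingCoeff ^ m) * H = S * R := by
  obtain ⟨m, S, H', e, he⟩ :=
    exists_pow_leadingCoeff_mul_eq R (H.natDegree + 1) H (Nat.lt_succ_self _)
  refine ⟨m, S, ?_⟩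
  suffices H' = 0 by rw [e, this, add_zero]
  rcases he with he | he
  · exact he
  · have hd : R.map f ∣ H'.map f := by
      have : H' = C (R.leadingCoeff ^ m) * H - S * R := by rw [e]; ring
      rw [this, Polynomial.map_sub, Polynomial.map_mul, Polynomial.map_mul]
      exact dvd_sub (h.mul_left _) (dvd_mul_left _ _)
    by_contra h0
    have h1 := natDegree_le_of_dvd hd ((Polynomial.map_ne_zero_iff hf).2 h0)
    rw [natDegree_map_eq_of_injective hf, natDegree_map_eq_of_injective hf] at h1
    omega

end DomainStructure

section FieldExtension

variable {A K : Type*} [CommRing A] [Field K] {P Q : A[X]}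

lemma rho_succ_ne_zero_of_injective {f : A →+* K} (hf : Function.Injective f) (hQ : Q ≠ 0)
    (hPQ : Q.natDegree < P.natDegree) {i : ℕ} (h : seqR P Q i ≠ 0) : rho P Q (i + 1) ≠ 0 := by
  have := (seqR_structure i (P := P.map f) (Q := Q.map f)
    ((Polynomial.map_ne_zero_iff hf).2 hQ)
    (by rwa [natDegree_map_eq_of_injective hf, natDegree_map_eq_of_injective hf])).1
    (by rw [← seqR_map hf]; exact (Polynomial.map_ne_zero_iff hf).2 h)
  rw [← rho_map hf] at this
  exact fun h0 => this (by rw [h0, map_zero])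

lemma exists_seqR_relation_of_injective {f : A →+* K} (hf : Function.Injective f) (hQ : Q ≠ 0)
    (hPQ : Q.natDegree < P.natDegree) {i : ℕ} (h : seqR P Q (i + 1) ≠ 0) :
    ∃ (m : ℕ) (S : A[X]), C (tau P Q (i + 1) ^ m) *
      (C (rho P Q (i + 2) * tau P Q (i + 1)) * seqR P Q i +
        C (rho P Q (i + 1) * tau P Q i) * seqR P Q (i + 2)) = S * seqR P Q (i + 1) := by
  refine exists_pow_leadingCoeff_mul_eq_of_dvd hf ?_
  have := (seqR_structure i (P := P.map f) (Q := Q.map f)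
    ((Polynomial.map_ne_zero_iff hf).2 hQ)
    (by rwa [natDegree_map_eq_of_injective hf, natDegree_map_eq_of_injective hf])).2
    (by rw [← seqR_map hf]; exact (Polynomial.map_ne_zero_iff hf).2 h)
  rw [Polynomial.map_add, Polynomial.map_mul, Polynomial.map_mul, map_C, map_C, f.map_mul,
    f.map_mul, seqR_map hf, seqR_map hf, seqR_map hf, tau_map hf, tau_map hf, rho_map hf,
    rho_map hf]
  exact this

lemma exists_seqR_one_relation_of_injective {f : A →+* K} (hf : Function.Injective f)
    (hQ : Q ≠ 0) (hPQ : Q.natDegree < P.natDegree) :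
    ∃ (m : ℕ) (S : A[X]), C (tau P Q 0 ^ m) *
      (seqR P Q 1 - C ((-1) ^ ((P.natDegree - Q.natDegree + 1) *
        (P.natDegree - Q.natDegree + 1 + 1) / 2) *
        tau P Q 0 ^ (P.natDegree - Q.natDegree + 1)) * P) = S * Q := by
  refine exists_pow_leadingCoeff_mul_eq_of_dvd hf ?_
  have := dvd_seqR_one_sub (P := P.map f) (Q := Q.map f) ((Polynomial.map_ne_zero_iff hf).2 hQ)
    (by rwa [natDegree_map_eq_of_injective hf, natDegree_map_eq_of_injective hf])
  rw [natDegree_map_eq_of_injective hf, natDegree_map_eq_of_injective hf,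
    leadingCoeff_map_of_injective hf, ← seqR_map hf] at this
  have ht : tau P Q 0 = Q.leadingCoeff := rfl
  rw [ht, Polynomial.map_sub, Polynomial.map_mul, map_C, f.map_mul, f.map_pow, f.map_pow,
    f.map_neg, f.map_one]
  exact this

end FieldExtension

/-! ### Sign variations -/

lemma signVar_zero_cons (l : List SignType) : signVar (0 :: l) = signVar l := by
  simp [signVar]

lemma signVar_cons_cons {a b : SignType} (ha : a ≠ 0) (hb : b ≠ 0) (l : List SignType) :
    signVar (a :: b :: l) = (if a * b = -1 then 1 else 0) + signVar (b :: l) := by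
  simp only [signVar]
  rw [List.filter_cons_of_pos (by simpa using ha), List.filter_cons_of_pos (by simpa using hb)]
  simp only [List.tail_cons, List.zip_cons_cons, List.countP_cons]
  simp [add_comm]

lemma signVar_cons_of_ne_zero {a b : SignType} (hb : b ≠ 0) (l : List SignType) :
    signVar (a :: b :: l) = (if a * b = -1 then 1 else 0) + signVar (b :: l) := by
  by_cases ha : a = 0
  · subst ha
    simp [signVar_zero_cons]
  · exact signVar_cons_cons ha hb l

lemma signVar_singleton (a : SignType) : signVar [a] = 0 := by
  revert a; decide

/-- A term between two terms of opposite signs may be replaced by any other one. -/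
lemma signVar_opposite {a b : SignType} (h : a * b = -1) (u : SignType) (l : List SignType) :
    signVar (a :: u :: b :: l) = 1 + signVar (b :: l) := by
  have ha : a ≠ 0 := by rintro rfl; simp at h
  have hb : b ≠ 0 := by rintro rfl; simp at h
  by_cases hu : u = 0
  · subst hu
    have : signVar (a :: 0 :: b :: l) = signVar (a :: b :: l) := by
      simp [signVar, List.filter_cons, ha]
    rw [this, signVar_cons_cons ha hb, if_pos h]
  · rw [signVar_cons_cons ha hu, signVar_cons_cons hu hb, ← add_assoc]
    congr 1
    revert a b u
    decide

lemma signVar_map_mul {e : SignType} (he : e ≠ 0) (l : List SignType) :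
    signVar (l.map (e * ·)) = signVar l := by
  have hee : e * e = 1 := by revert e; decide
  have h1 : (l.map (e * ·)).filter (· ≠ 0) = (l.filter (· ≠ 0)).map (e * ·) := by
    rw [List.filter_map]
    congr 2
    funext a
    simp [he]
  simp only [signVar]
  rw [h1, ← List.map_tail, List.zip_map, List.countP_map]
  congr 1
  funext s
  have : e * s.1 * (e * s.2) = s.1 * s.2 := by
    rw [mul_mul_mul_comm, hee, one_mul]
  simp [this]

lemma map_range_succ {β : Type*} (u : ℕ → β) (n : ℕ) :
    (List.range (n + 1)).map u = u 0 :: (List.range n).map fun i => u (i + 1) := by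
  simp [List.range_succ_eq_map, Function.comp_def]

/-- In a tuple of signs with nonzero ends whose inner zeros have neighbours of opposite signs,
replacing the zeros does not change the number of variations. -/
lemma signVar_eq_of_perturbation : ∀ (N : ℕ) (t u : ℕ → SignType), t 0 ≠ 0 → t N ≠ 0 →
    (∀ i ≤ N, t i ≠ 0 → u i = t i) → (∀ i, i + 2 ≤ N → t (i + 1) = 0 → t i * t (i + 2) = -1) →
    signVar ((List.range (N + 1)).map u) = signVar ((List.range (N + 1)).map t) := by
  intro N
  induction N using Nat.strong_induction_on with
  | _ N ih =>
    intro t u h0 hN hu hz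
    match N, ih, hN, hu, hz with
    | 0, _, _, _, _ => simp [signVar_singleton]
    | N + 1, ih, hN, hu, hz =>
      have u0 : u 0 = t 0 := hu 0 (by omega) h0
      by_cases h1 : t 1 = 0
      · match N, ih, hN, hu, hz with
        | 0, _, hN, _, _ => exact absurd h1 hN
        | N + 1, ih, hN, hu, hz =>
          have ht := hz 0 (by omega) h1
          have h2 : t 2 ≠ 0 := by
            intro h2
            rw [zero_add, h2, mul_zero] at ht
            exact absurd ht (by decide)
          have u2 : u 2 = t 2 := hu 2 (by omega) h2
          have key := ih N (by omega) (fun i => t (i + 2)) (fun i => u (i + 2)) h2 hN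
            (fun i hi => hu (i + 2) (by omega)) (fun i hi => hz (i + 2) (by omega))
          rw [map_range_succ, map_range_succ] at key
          simp only [map_range_succ, zero_add] at key ⊢
          rw [u0, u2] at *
          rw [signVar_opposite ht, signVar_opposite ht, ← key]
      · have u1 : u 1 = t 1 := hu 1 (by omega) h1
        have key := ih N (by omega) (fun i => t (i + 1)) (fun i => u (i + 1)) h1 hN
          (fun i hi => hu (i + 1) (by omega)) (fun i hi => hz (i + 1) (by omega))
        rw [map_range_succ, map_range_succ] at key
        rw [map_range_succ, map_range_succ, map_range_succ, map_range_succ]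
        simp only [zero_add] at key ⊢
        rw [u0, u1] at *
        rw [signVar_cons_cons h0 h1, signVar_cons_cons h0 h1, key]

/-! ### The derivation attached to the differential equation -/

section Derivation

lemma partialX_add (F G : ℤ[X][Y]) : partialX (F + G) = partialX F + partialX G :=
  sum_add_index F G _ (by simp) (by simp)

lemma partialX_monomial (n : ℕ) (c : ℤ[X]) :
    partialX (monomial n c) = monomial n (derivative c) :=
  sum_monomial_index c (fun n c => monomial n (derivative c)) (by simp)

lemma partialX_mul (F G : ℤ[X][Y]) :
    partialX (F * G) = partialX F * G + F * partialX G := by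
  induction F using Polynomial.induction_on' with
  | add F₁ F₂ h₁ h₂ => simp only [add_mul, partialX_add, h₁, h₂]; ring
  | monomial n a =>
    induction G using Polynomial.induction_on' with
    | add G₁ G₂ h₁ h₂ => simp only [mul_add, partialX_add, h₁, h₂]; ring
    | monomial m b =>
      simp only [monomial_mul_monomial, partialX_monomial, derivative_mul, map_add]

lemma coeff_partialX (F : ℤ[X][Y]) (n : ℕ) :
    (partialX F).coeff n = derivative (F.coeff n) := by
  induction F using Polynomial.induction_on' with
  | add F₁ F₂ h₁ h₂ => simp only [partialX_add, coeff_add, h₁, h₂, derivative_add]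
  | monomial m a =>
    rw [partialX_monomial, coeff_monomial, coeff_monomial]
    split_ifs <;> simp

variable (Φ : ℤ[X][Y])

lemma tildePoly_add (F G : ℤ[X][Y]) :
    tildePoly Φ (F + G) = tildePoly Φ F + tildePoly Φ G := by
  simp only [tildePoly, partialX_add, derivative_add]; ring

lemma tildePoly_mul (F G : ℤ[X][Y]) :
    tildePoly Φ (F * G) = tildePoly Φ F * G + F * tildePoly Φ G := by
  simp only [tildePoly, partialX_mul, derivative_mul]; ring

lemma tildePoly_zero : tildePoly Φ 0 = 0 := by
  simp [tildePoly, partialX]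

/-- The ideal generated by all the derivatives of a polynomial is closed under the derivation. -/
lemma tildePoly_mem_span (H : ℤ[X][Y]) {E : ℤ[X][Y]}
    (hE : E ∈ Ideal.span (Set.range fun i : ℕ => (tildePoly Φ)^[i] H)) :
    tildePoly Φ E ∈ Ideal.span (Set.range fun i : ℕ => (tildePoly Φ)^[i] H) := by
  induction hE using Submodule.span_induction with
  | mem x hx =>
    obtain ⟨i, rfl⟩ := hx
    refine Ideal.subset_span ⟨i + 1, ?_⟩
    simp only [Function.iterate_succ', Function.comp_apply]
  | zero => simp [tildePoly_zero]
  | add x y _ _ hx hy => rw [tildePoly_add]; exact add_mem hx hy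
  | smul a x hx h =>
    rw [smul_eq_mul, tildePoly_mul]
    exact add_mem (Ideal.mul_mem_left _ _ hx) (Ideal.mul_mem_left _ _ h)

end Derivation

/-! ### Polynomials in a solution of the differential equation -/

section Pfaffian

variable {φ : ℝ → ℝ}

lemma pfaff_zero (x : ℝ) : pfaff φ 0 x = 0 := map_zero _

lemma pfaff_add (F G : ℤ[X][Y]) (x : ℝ) : pfaff φ (F + G) x = pfaff φ F x + pfaff φ G x :=
  map_add _ _ _

lemma pfaff_sub (F G : ℤ[X][Y]) (x : ℝ) : pfaff φ (F - G) x = pfaff φ F x - pfaff φ G x :=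
  map_sub _ _ _

lemma pfaff_mul (F G : ℤ[X][Y]) (x : ℝ) : pfaff φ (F * G) x = pfaff φ F x * pfaff φ G x :=
  map_mul _ _ _

lemma pfaff_C (c : ℤ[X]) (x : ℝ) : pfaff φ (C c) x = aeval x c :=
  aevalAeval_C _ _ _

lemma pfaff_monomial (n : ℕ) (c : ℤ[X]) (x : ℝ) :
    pfaff φ (monomial n c) x = aeval x c * φ x ^ n := by
  rw [← C_mul_X_pow_eq_monomial, pfaff_mul, pfaff_C]
  congr 1
  rw [pfaff, map_pow, aevalAeval_Y]

lemma pfaff_sum {ι : Type*} (s : Finset ι) (f : ι → ℤ[X][Y]) (x : ℝ) :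
    pfaff φ (∑ i ∈ s, f i) x = ∑ i ∈ s, pfaff φ (f i) x :=
  map_sum _ _ _

variable {Φ : ℤ[X][Y]}

lemma hasDerivWithinAt_pfaff {S : Set ℝ} {x : ℝ} (hφ : HasDerivWithinAt φ (pfaff φ Φ x) S x)
    (H : ℤ[X][Y]) : HasDerivWithinAt (pfaff φ H) (pfaff φ (tildePoly Φ H) x) S x := by
  induction H using Polynomial.induction_on' with
  | add F G hF hG =>
    rw [tildePoly_add, pfaff_add]
    exact (hF.add hG).congr_of_eventuallyEq (Eventually.of_forall fun y => pfaff_add F G y)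
      (pfaff_add F G x)
  | monomial n c =>
    have h := ((c.hasDerivAt_aeval x).hasDerivWithinAt (s := S)).mul (hφ.pow n)
    have hfun : pfaff φ (monomial n c) = (fun y => aeval y c) * φ ^ n := by
      funext y
      simp [pfaff_monomial]
    rw [hfun]
    refine h.congr_deriv ?_
    simp only [tildePoly, partialX_monomial, derivative_monomial, pfaff_add, pfaff_mul,
      pfaff_monomial, Pi.pow_apply, map_mul, map_natCast]
    ring

variable {α β : ℝ}

lemma continuousOn_pfaff (hφ : ∀ x ∈ Icc α β, HasDerivWithinAt φ (pfaff φ Φ x) (Icc α β) x)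
    (H : ℤ[X][Y]) : ContinuousOn (pfaff φ H) (Icc α β) :=
  fun x hx => (hasDerivWithinAt_pfaff (hφ x hx) H).continuousWithinAt

lemma hasDerivAt_pfaff (hφ : ∀ x ∈ Icc α β, HasDerivWithinAt φ (pfaff φ Φ x) (Icc α β) x)
    (H : ℤ[X][Y]) {x : ℝ} (hx : x ∈ Ioo α β) :
    HasDerivAt (pfaff φ H) (pfaff φ (tildePoly Φ H) x) x :=
  (hasDerivWithinAt_pfaff (hφ x (Ioo_subset_Icc_self hx)) H).hasDerivAt
    (Icc_mem_nhds hx.1 hx.2)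

/-- A nonnegative function with `|w'| ≤ K w` that vanishes at one point vanishes identically. -/
lemma eq_zero_of_abs_deriv_le {w w' : ℝ → ℝ} {K c : ℝ} (hc : c ∈ Icc α β)
    (hw : ∀ x ∈ Icc α β, HasDerivWithinAt w (w' x) (Icc α β) x)
    (hnn : ∀ x, 0 ≤ w x) (hK : ∀ x ∈ Icc α β, |w' x| ≤ K * w x) (h0 : w c = 0) :
    ∀ x ∈ Icc α β, w x = 0 := by
  intro x hx
  have key : ∀ s : ℝ, ∀ y ∈ Icc α β, HasDerivWithinAt (fun y => w y * Real.exp (s * y))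
      ((w' y + s * w y) * Real.exp (s * y)) (Icc α β) y := by
    intro s y hy
    have h1 : HasDerivWithinAt (fun y : ℝ => Real.exp (s * y)) (Real.exp (s * y) * (s * 1))
        (Icc α β) y := ((hasDerivWithinAt_id y _).const_mul s).exp
    refine ((hw y hy).mul h1).congr_deriv ?_
    ring
  refine le_antisymm ?_ (hnn x)
  rcases le_total c x with h | h
  · have hanti : AntitoneOn (fun y => w y * Real.exp (-K * y)) (Icc α β) := by
      refine antitoneOn_of_hasDerivWithinAt_nonpos (convex_Icc α β)
        (fun y hy => (key (-K) y hy).continuousWithinAt)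
        (fun y hy => (key (-K) y (interior_subset hy)).mono interior_subset) ?_
      intro y hy
      have := (abs_le.1 (hK y (interior_subset hy))).2
      exact mul_nonpos_of_nonpos_of_nonneg (by linarith) (Real.exp_pos _).le
    have := hanti hc hx h
    simp only [h0, zero_mul] at this
    exact nonpos_of_mul_nonpos_left this (Real.exp_pos _)
  · have hmono : MonotoneOn (fun y => w y * Real.exp (K * y)) (Icc α β) := by
      refine monotoneOn_of_hasDerivWithinAt_nonneg (convex_Icc α β)
        (fun y hy => (key K y hy).continuousWithinAt)
        (fun y hy => (key K y (interior_subset hy)).mono interior_subset) ?_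
      intro y hy
      have := (abs_le.1 (hK y (interior_subset hy))).1
      exact mul_nonneg (by linarith) (Real.exp_pos _).le
    have := hmono hx hc h
    simp only [h0, zero_mul] at this
    exact nonpos_of_mul_nonpos_left this (Real.exp_pos _)

/-- If all the derivatives of `x ↦ H(x, φ(x))` vanish at one point, then the function is zero: by
noetherianity finitely many elements `E` of the differential ideal generated by `H` satisfy a
linear system of differential equations, and `w = ∑ E(x, φ(x))²` obeys `|w'| ≤ K w`. -/
theorem pfaff_eq_zero_of_flat
    (hφ : ∀ x ∈ Icc α β, HasDerivWithinAt φ (pfaff φ Φ x) (Icc α β) x)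
    {H : ℤ[X][Y]} {c : ℝ} (hc : c ∈ Icc α β)
    (h : ∀ i : ℕ, pfaff φ ((tildePoly Φ)^[i] H) c = 0) : ∀ x ∈ Icc α β, pfaff φ H x = 0 := by
  set J : Ideal ℤ[X][Y] := Ideal.span (Set.range fun i : ℕ => (tildePoly Φ)^[i] H) with hJ
  have hker : ∀ E ∈ J, pfaff φ E c = 0 := by
    intro E hE
    have : J ≤ RingHom.ker (aevalAeval (R := ℤ) c (φ c)) := by
      rw [hJ, Ideal.span_le]
      rintro _ ⟨i, rfl⟩
      exact h i
    exact this hE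
  obtain ⟨s, hs⟩ := (isNoetherian_def.1 (inferInstance : IsNoetherianRing ℤ[X][Y])) J
  have hsJ : ∀ E ∈ s, E ∈ J := fun E hE => by rw [← hs]; exact Submodule.subset_span hE
  have hcomb : ∀ E ∈ J, ∃ a : ℤ[X][Y] → ℤ[X][Y], ∑ t ∈ s, a t * t = E := by
    intro E hE
    rw [← hs] at hE
    obtain ⟨a, -, ha⟩ := Submodule.mem_span_finset.1 hE
    exact ⟨a, ha⟩
  have hder : ∀ E ∈ s, ∃ a : ℤ[X][Y] → ℤ[X][Y], ∑ t ∈ s, a t * t = tildePoly Φ E :=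
    fun E hE => hcomb _ (tildePoly_mem_span Φ H (hsJ E hE))
  choose! a ha using hder
  have hbound : ∀ E, ∃ B, ∀ x ∈ Icc α β, |pfaff φ E x| ≤ B := by
    intro E
    obtain ⟨B, hB⟩ := isCompact_Icc.exists_bound_of_continuousOn (continuousOn_pfaff hφ E)
    exact ⟨B, fun x hx => hB x hx⟩
  choose B hB using hbound
  set w : ℝ → ℝ := fun x => ∑ E ∈ s, pfaff φ E x ^ 2 with hw
  have hle : ∀ x, ∀ E ∈ s, pfaff φ E x ^ 2 ≤ w x := fun x E hE =>
    Finset.single_le_sum (f := fun E => pfaff φ E x ^ 2) (fun _ _ => sq_nonneg _) hE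
  have hw0 := eq_zero_of_abs_deriv_le (w := w)
    (w' := fun x => ∑ E ∈ s, ∑ t ∈ s, 2 * pfaff φ E x * (pfaff φ (a E t) x * pfaff φ t x))
    (K := ∑ E ∈ s, ∑ t ∈ s, 2 * B (a E t)) hc ?_ (fun x => Finset.sum_nonneg fun _ _ =>
      sq_nonneg _) ?_ (Finset.sum_eq_zero fun E hE => by rw [hker E (hsJ E hE)]; simp)
  · intro x hx
    obtain ⟨b, hb⟩ := hcomb H (Ideal.subset_span ⟨0, rfl⟩)
    rw [← hb, pfaff_sum]
    refine Finset.sum_eq_zero fun E hE => ?_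
    have h1 := hle x E hE
    rw [hw0 x hx] at h1
    rw [pfaff_mul, pow_eq_zero_iff two_ne_zero |>.1 (le_antisymm h1 (sq_nonneg _)), mul_zero]
  · intro x hx
    have : HasDerivWithinAt (fun x => ∑ E ∈ s, pfaff φ E x ^ 2)
        (∑ E ∈ s, ∑ t ∈ s, 2 * pfaff φ E x * (pfaff φ (a E t) x * pfaff φ t x))
        (Icc α β) x := by
      refine HasDerivWithinAt.fun_sum fun E hE => ?_
      refine ((hasDerivWithinAt_pfaff (hφ x hx) E).pow 2).congr_deriv ?_
      rw [← ha E hE, pfaff_sum, ← Finset.mul_sum]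
      simp [pfaff_mul]
    exact this
  · intro x hx
    rw [Finset.sum_mul]
    refine (Finset.abs_sum_le_sum_abs _ _).trans (Finset.sum_le_sum fun E hE => ?_)
    rw [Finset.sum_mul]
    refine (Finset.abs_sum_le_sum_abs _ _).trans (Finset.sum_le_sum fun t ht => ?_)
    have h1 := hle x E hE
    have h2 := hle x t ht
    have h3 : |pfaff φ E x * pfaff φ t x| ≤ w x := by
      rw [abs_le]
      constructor <;> nlinarith [sq_nonneg (pfaff φ E x - pfaff φ t x),
        sq_nonneg (pfaff φ E x + pfaff φ t x)]
    have h4 : |2 * pfaff φ E x * (pfaff φ (a E t) x * pfaff φ t x)| =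
        2 * |pfaff φ (a E t) x| * |pfaff φ E x * pfaff φ t x| := by
      rw [show 2 * pfaff φ E x * (pfaff φ (a E t) x * pfaff φ t x) =
        2 * pfaff φ (a E t) x * (pfaff φ E x * pfaff φ t x) by ring, abs_mul, abs_mul]
      simp
    rw [h4]
    have h5 := hB (a E t) x hx
    exact mul_le_mul (by linarith) h3 (abs_nonneg _) (by linarith [abs_nonneg (pfaff φ (a E t) x)])

end Pfaffian

/-! ### Orders of vanishing -/

section Order

/-- One step of L'Hôpital's rule for the order of vanishing, from the right. -/
lemma tendsto_div_pow_succ_right {f f' : ℝ → ℝ} {c L : ℝ} (m : ℕ)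
    (hf : ∀ᶠ x in 𝓝[>] c, HasDerivAt f (f' x) x) (h0 : Tendsto f (𝓝[>] c) (𝓝 0))
    (h : Tendsto (fun x => f' x / (x - c) ^ m) (𝓝[>] c) (𝓝 L)) :
    Tendsto (fun x => f x / (x - c) ^ (m + 1)) (𝓝[>] c) (𝓝 (L / (m + 1))) := by
  refine HasDerivAt.lhopital_zero_nhdsGT hf (g' := fun x => (m + 1) * (x - c) ^ m)
    (Eventually.of_forall fun x => ?_) ?_ h0 ?_ ?_
  · exact (((hasDerivAt_id x).sub_const c).pow (m + 1)).congr_deriv (by simp)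
  · filter_upwards [self_mem_nhdsWithin] with x hx
    exact mul_ne_zero (by positivity) (pow_ne_zero _ (sub_ne_zero.2 (ne_of_gt hx)))
  · have : Tendsto (fun x : ℝ => (x - c) ^ (m + 1)) (𝓝 c) (𝓝 ((c - c) ^ (m + 1))) :=
      Continuous.tendsto (by fun_prop) c
    simp only [sub_self, zero_pow (Nat.succ_ne_zero m)] at this
    exact this.mono_left nhdsWithin_le_nhds
  · refine (h.div_const ((m : ℝ) + 1)).congr fun x => ?_
    rw [div_div, mul_comm]

/-- One step of L'Hôpital's rule for the order of vanishing, from the left. -/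
lemma tendsto_div_pow_succ_left {f f' : ℝ → ℝ} {c L : ℝ} (m : ℕ)
    (hf : ∀ᶠ x in 𝓝[<] c, HasDerivAt f (f' x) x) (h0 : Tendsto f (𝓝[<] c) (𝓝 0))
    (h : Tendsto (fun x => f' x / (x - c) ^ m) (𝓝[<] c) (𝓝 L)) :
    Tendsto (fun x => f x / (x - c) ^ (m + 1)) (𝓝[<] c) (𝓝 (L / (m + 1))) := by
  refine HasDerivAt.lhopital_zero_nhdsLT hf (g' := fun x => (m + 1) * (x - c) ^ m)
    (Eventually.of_forall fun x => ?_) ?_ h0 ?_ ?_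
  · exact (((hasDerivAt_id x).sub_const c).pow (m + 1)).congr_deriv (by simp)
  · filter_upwards [self_mem_nhdsWithin] with x hx
    exact mul_ne_zero (by positivity) (pow_ne_zero _ (sub_ne_zero.2 (ne_of_lt hx)))
  · have : Tendsto (fun x : ℝ => (x - c) ^ (m + 1)) (𝓝 c) (𝓝 ((c - c) ^ (m + 1))) :=
      Continuous.tendsto (by fun_prop) c
    simp only [sub_self, zero_pow (Nat.succ_ne_zero m)] at this
    exact this.mono_left nhdsWithin_le_nhds
  · refine (h.div_const ((m : ℝ) + 1)).congr fun x => ?_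
    rw [div_div, mul_comm]

variable {φ : ℝ → ℝ} {Φ : ℤ[X][Y]} {α β : ℝ}

lemma tendsto_pfaff_right (hφ : ∀ x ∈ Icc α β, HasDerivWithinAt φ (pfaff φ Φ x) (Icc α β) x)
    (H : ℤ[X][Y]) {c : ℝ} (hc : c ∈ Ico α β) :
    Tendsto (pfaff φ H) (𝓝[>] c) (𝓝 (pfaff φ H c)) :=
  (continuousOn_pfaff hφ H c (Ico_subset_Icc_self hc)).mono_left
    (nhdsWithin_le_iff.2 (Filter.mem_of_superset (Ioo_mem_nhdsGT hc.2)
      fun _ hx => ⟨hc.1.trans hx.1.le, hx.2.le⟩))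

lemma tendsto_pfaff_left (hφ : ∀ x ∈ Icc α β, HasDerivWithinAt φ (pfaff φ Φ x) (Icc α β) x)
    (H : ℤ[X][Y]) {c : ℝ} (hc : c ∈ Ioc α β) :
    Tendsto (pfaff φ H) (𝓝[<] c) (𝓝 (pfaff φ H c)) :=
  (continuousOn_pfaff hφ H c (Ioc_subset_Icc_self hc)).mono_left
    (nhdsWithin_le_iff.2 (Filter.mem_of_superset (Ioo_mem_nhdsLT hc.1)
      fun _ hx => ⟨hx.1.le, hx.2.le.trans hc.2⟩))

lemma tendsto_pfaff_div_pow_right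
    (hφ : ∀ x ∈ Icc α β, HasDerivWithinAt φ (pfaff φ Φ x) (Icc α β) x)
    {c : ℝ} (hc : c ∈ Ico α β) (m : ℕ) : ∀ H : ℤ[X][Y],
    (∀ i < m, pfaff φ ((tildePoly Φ)^[i] H) c = 0) →
    Tendsto (fun x => pfaff φ H x / (x - c) ^ m) (𝓝[>] c)
      (𝓝 (pfaff φ ((tildePoly Φ)^[m] H) c / (m.factorial : ℝ))) := by
  induction m with
  | zero =>
    intro H _
    simpa using tendsto_pfaff_right hφ H hc
  | succ m ih =>
    intro H hH
    have h := ih (tildePoly Φ H) fun i hi => hH (i + 1) (by omega)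
    have h0 := tendsto_pfaff_right hφ H hc
    rw [show pfaff φ H c = 0 from hH 0 (by omega)] at h0
    have := tendsto_div_pow_succ_right m (by
      filter_upwards [Ioo_mem_nhdsGT hc.2] with x hx
      exact hasDerivAt_pfaff hφ H ⟨hc.1.trans_lt hx.1, hx.2⟩) h0 h
    rw [div_div] at this
    rw [Nat.factorial_succ, mul_comm (m + 1)]
    exact_mod_cast this

lemma tendsto_pfaff_div_pow_left
    (hφ : ∀ x ∈ Icc α β, HasDerivWithinAt φ (pfaff φ Φ x) (Icc α β) x)
    {c : ℝ} (hc : c ∈ Ioc α β) (m : ℕ) : ∀ H : ℤ[X][Y],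
    (∀ i < m, pfaff φ ((tildePoly Φ)^[i] H) c = 0) →
    Tendsto (fun x => pfaff φ H x / (x - c) ^ m) (𝓝[<] c)
      (𝓝 (pfaff φ ((tildePoly Φ)^[m] H) c / (m.factorial : ℝ))) := by
  induction m with
  | zero =>
    intro H _
    simpa using tendsto_pfaff_left hφ H hc
  | succ m ih =>
    intro H hH
    have h := ih (tildePoly Φ H) fun i hi => hH (i + 1) (by omega)
    have h0 := tendsto_pfaff_left hφ H hc
    rw [show pfaff φ H c = 0 from hH 0 (by omega)] at h0
    have := tendsto_div_pow_succ_left m (by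
      filter_upwards [Ioo_mem_nhdsLT hc.1] with x hx
      exact hasDerivAt_pfaff hφ H ⟨hx.1, hx.2.trans_le hc.2⟩) h0 h
    rw [div_div] at this
    rw [Nat.factorial_succ, mul_comm (m + 1)]
    exact_mod_cast this

/-- The order of vanishing of `x ↦ H(x, φ(x))` at a point is finite. -/
lemma exists_order (hφ : ∀ x ∈ Icc α β, HasDerivWithinAt φ (pfaff φ Φ x) (Icc α β) x)
    {H : ℤ[X][Y]} (hH : ∃ x ∈ Icc α β, pfaff φ H x ≠ 0) {c : ℝ} (hc : c ∈ Icc α β) :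
    ∃ m, (∀ i < m, pfaff φ ((tildePoly Φ)^[i] H) c = 0) ∧
      pfaff φ ((tildePoly Φ)^[m] H) c ≠ 0 := by
  classical
  have h : ∃ m, pfaff φ ((tildePoly Φ)^[m] H) c ≠ 0 := by
    by_contra! h
    obtain ⟨x, hx, hne⟩ := hH
    exact hne (pfaff_eq_zero_of_flat hφ hc h x hx)
  exact ⟨Nat.find h, fun i hi => not_not.1 (Nat.find_min h hi), Nat.find_spec h⟩

lemma eventually_sign_right
    (hφ : ∀ x ∈ Icc α β, HasDerivWithinAt φ (pfaff φ Φ x) (Icc α β) x)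
    {H : ℤ[X][Y]} (hH : ∃ x ∈ Icc α β, pfaff φ H x ≠ 0) {c : ℝ} (hc : c ∈ Ico α β) :
    (∀ᶠ x in 𝓝[>] c, 0 < pfaff φ H x) ∨ (∀ᶠ x in 𝓝[>] c, pfaff φ H x < 0) := by
  obtain ⟨m, hm, hne⟩ := exists_order hφ hH (Ico_subset_Icc_self hc)
  have ht := tendsto_pfaff_div_pow_right hφ hc m H hm
  have hpos : ∀ᶠ x in 𝓝[>] c, 0 < (x - c) ^ m := by
    filter_upwards [self_mem_nhdsWithin] with x hx
    exact pow_pos (sub_pos.2 hx) m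
  rcases hne.lt_or_gt with h | h
  · right
    filter_upwards [ht.eventually_lt_const (div_neg_of_neg_of_pos h (by positivity)), hpos]
      with x h1 h2
    exact (div_neg_iff.1 h1).elim (fun h => absurd h.2 h2.not_gt) fun h => h.1
  · left
    filter_upwards [ht.eventually_const_lt (div_pos h (by positivity)), hpos] with x h1 h2
    exact (div_pos_iff_of_pos_right h2).1 h1

lemma eventually_sign_left
    (hφ : ∀ x ∈ Icc α β, HasDerivWithinAt φ (pfaff φ Φ x) (Icc α β) x)
    {H : ℤ[X][Y]} (hH : ∃ x ∈ Icc α β, pfaff φ H x ≠ 0) {c : ℝ} (hc : c ∈ Ioc α β) :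
    (∀ᶠ x in 𝓝[<] c, 0 < pfaff φ H x) ∨ (∀ᶠ x in 𝓝[<] c, pfaff φ H x < 0) := by
  obtain ⟨m, hm, hne⟩ := exists_order hφ hH (Ioc_subset_Icc_self hc)
  have ht := tendsto_pfaff_div_pow_left hφ hc m H hm
  have key : ∀ {L : ℝ}, Tendsto (fun x => pfaff φ H x / (c - x) ^ m) (𝓝[<] c) (𝓝 L) → L ≠ 0 →
      (∀ᶠ x in 𝓝[<] c, 0 < pfaff φ H x) ∨ (∀ᶠ x in 𝓝[<] c, pfaff φ H x < 0) := by
    intro L hL hL0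
    have hpos : ∀ᶠ x in 𝓝[<] c, 0 < (c - x) ^ m := by
      filter_upwards [self_mem_nhdsWithin] with x hx
      exact pow_pos (sub_pos.2 hx) m
    rcases hL0.lt_or_gt with h | h
    · right
      filter_upwards [hL.eventually_lt_const h, hpos] with x h1 h2
      exact (div_neg_iff.1 h1).elim (fun h => absurd h.2 h2.not_gt) fun h => h.1
    · left
      filter_upwards [hL.eventually_const_lt h, hpos] with x h1 h2
      exact (div_pos_iff_of_pos_right h2).1 h1
  refine key (L := (-1) ^ m * (pfaff φ ((tildePoly Φ)^[m] H) c / (m.factorial : ℝ)))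
    ((ht.const_mul ((-1) ^ m)).congr fun x => ?_)
    (mul_ne_zero (pow_ne_zero _ (by norm_num)) (div_ne_zero hne (by positivity)))
  have : (c - x) ^ m = (-1) ^ m * (x - c) ^ m := by rw [← mul_pow]; ring
  have h1 : ((-1 : ℝ) ^ m) * (-1) ^ m = 1 := by rw [← mul_pow]; simp
  have h2 : ((-1 : ℝ) ^ m)⁻¹ = (-1) ^ m := inv_eq_of_mul_eq_one_left h1
  rw [this, div_eq_mul_inv, div_eq_mul_inv, mul_inv, h2]
  ring

lemma eventually_ne_zero
    (hφ : ∀ x ∈ Icc α β, HasDerivWithinAt φ (pfaff φ Φ x) (Icc α β) x)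
    {H : ℤ[X][Y]} (hH : ∃ x ∈ Icc α β, pfaff φ H x ≠ 0) {c : ℝ} (hc : c ∈ Ioo α β) :
    ∀ᶠ x in 𝓝[≠] c, pfaff φ H x ≠ 0 := by
  rw [← Iio_union_Ioi, nhdsWithin_union, eventually_sup]
  constructor
  · rcases eventually_sign_left hφ hH (Ioo_subset_Ioc_self hc) with h | h
    · exact h.mono fun _ hx => hx.ne'
    · exact h.mono fun _ hx => hx.ne
  · rcases eventually_sign_right hφ hH (Ioo_subset_Ico_self hc) with h | h
    · exact h.mono fun _ hx => hx.ne'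
    · exact h.mono fun _ hx => hx.ne

/-- A function `x ↦ H(x, φ(x))` that is not identically zero has finitely many zeros. -/
theorem finite_zeros_pfaff
    (hφ : ∀ x ∈ Icc α β, HasDerivWithinAt φ (pfaff φ Φ x) (Icc α β) x)
    {H : ℤ[X][Y]} (hH : ∃ x ∈ Icc α β, pfaff φ H x ≠ 0) :
    {x | x ∈ Icc α β ∧ pfaff φ H x = 0}.Finite := by
  by_contra hinf
  obtain ⟨c, hc, hacc⟩ := Set.Infinite.exists_accPt_of_subset_isCompact hinf isCompact_Icc
    fun x hx => hx.1
  rw [accPt_iff_frequently_nhdsNE] at hacc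
  apply hacc
  rw [← Iio_union_Ioi, nhdsWithin_union, eventually_sup]
  constructor
  · rcases hc.1.eq_or_lt with rfl | h
    · filter_upwards [self_mem_nhdsWithin] with x hx h
      exact absurd h.1.1 (not_le.2 hx)
    · rcases eventually_sign_left hφ hH ⟨h, hc.2⟩ with h | h
      · exact h.mono fun _ hx h => hx.ne' h.2
      · exact h.mono fun _ hx h => hx.ne h.2
  · rcases hc.2.eq_or_lt with rfl | h
    · filter_upwards [self_mem_nhdsWithin] with x hx h
      exact absurd h.1.2 (not_le.2 hx)
    · rcases eventually_sign_right hφ hH ⟨hc.1, h⟩ with h | h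
      · exact h.mono fun _ hx h => hx.ne' h.2
      · exact h.mono fun _ hx h => hx.ne h.2

/-- At a zero the logarithmic derivative has a simple pole with positive residue, the order of the
zero. -/
lemma exists_tendsto_logDeriv
    (hφ : ∀ x ∈ Icc α β, HasDerivWithinAt φ (pfaff φ Φ x) (Icc α β) x)
    {H : ℤ[X][Y]} (hH : ∃ x ∈ Icc α β, pfaff φ H x ≠ 0) {c : ℝ} (hc : c ∈ Ioo α β)
    (h0 : pfaff φ H c = 0) :
    ∃ r : ℝ, 0 < r ∧
      Tendsto (fun x => pfaff φ (tildePoly Φ H) x * (x - c) / pfaff φ H x) (𝓝[≠] c) (𝓝 r) := by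
  obtain ⟨m, hm, hne⟩ := exists_order hφ hH (Ioo_subset_Icc_self hc)
  obtain _ | m := m
  · exact absurd h0 hne
  refine ⟨m + 1, by positivity, ?_⟩
  have hm' : ∀ i < m, pfaff φ ((tildePoly Φ)^[i] (tildePoly Φ H)) c = 0 :=
    fun i hi => hm (i + 1) (by omega)
  have hL : pfaff φ ((tildePoly Φ)^[m] (tildePoly Φ H)) c / (m.factorial : ℝ) /
      (pfaff φ ((tildePoly Φ)^[m + 1] H) c / ((m + 1).factorial : ℝ)) = m + 1 := by
    rw [Function.iterate_succ_apply] at hne ⊢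
    rw [Nat.factorial_succ]
    push_cast
    field_simp
  have hL0 : pfaff φ ((tildePoly Φ)^[m + 1] H) c / ((m + 1).factorial : ℝ) ≠ 0 :=
    div_ne_zero hne (by positivity)
  have hcongr : ∀ x, x - c ≠ 0 →
      pfaff φ (tildePoly Φ H) x / (x - c) ^ m / (pfaff φ H x / (x - c) ^ (m + 1)) =
        pfaff φ (tildePoly Φ H) x * (x - c) / pfaff φ H x := by
    intro x hx
    rw [div_div_div_eq, pow_succ, ← mul_assoc, mul_right_comm, mul_comm ((x - c) ^ m),
      mul_div_mul_right _ _ (pow_ne_zero m hx)]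
  rw [← Iio_union_Ioi, nhdsWithin_union, tendsto_sup, ← hL]
  constructor
  · refine ((tendsto_pfaff_div_pow_left hφ (Ioo_subset_Ioc_self hc) m _ hm').div
      (tendsto_pfaff_div_pow_left hφ (Ioo_subset_Ioc_self hc) (m + 1) _ hm) hL0).congr' ?_
    filter_upwards [self_mem_nhdsWithin] with x hx
    exact hcongr x (sub_ne_zero.2 (ne_of_lt hx))
  · refine ((tendsto_pfaff_div_pow_right hφ (Ioo_subset_Ico_self hc) m _ hm').div
      (tendsto_pfaff_div_pow_right hφ (Ioo_subset_Ico_self hc) (m + 1) _ hm) hL0).congr' ?_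
    filter_upwards [self_mem_nhdsWithin] with x hx
    exact hcongr x (sub_ne_zero.2 (ne_of_gt hx))

end Order

/-! ### Sturm chains -/

section SturmChain

/-- The number of sign variations of `(p_0(x), …, p_N(x))`. -/
def signVarAt (N : ℕ) (p : ℕ → ℝ → ℝ) (x : ℝ) : ℕ :=
  signVar ((List.range (N + 1)).map fun i => SignType.sign (p i x))

/-- A generalized Sturm chain near `c`: the functions satisfy
`A_i p_i + B_i p_{i+2} = C_i p_{i+1}` with continuous coefficients, of which `A_i` and `B_i` are
positive at `c`, and `p_{N+1} = 0`. -/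
structure IsSturmChainAt (N : ℕ) (p A B C : ℕ → ℝ → ℝ) (c : ℝ) : Prop where
  continuousAt_A : ∀ i < N, ContinuousAt (A i) c
  continuousAt_B : ∀ i < N, ContinuousAt (B i) c
  continuousAt_C : ∀ i < N, ContinuousAt (C i) c
  A_pos : ∀ i < N, 0 < A i c
  B_pos : ∀ i < N, 0 < B i c
  relation : ∀ i < N, ∀ᶠ x in 𝓝 c, A i x * p i x + B i x * p (i + 2) x = C i x * p (i + 1) x
  last : ∀ᶠ x in 𝓝 c, p (N + 1) x = 0

/-- The quotients `p_i / p_N`, computed from the end of the chain: `chainQuotRev k` is the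
quotient of index `N + 1 - k`. -/
def chainQuotRev (N : ℕ) (A B C : ℕ → ℝ → ℝ) : ℕ → ℝ → ℝ
  | 0 => fun _ => 0
  | 1 => fun _ => 1
  | k + 2 => fun x => (C (N - 1 - k) x * chainQuotRev N A B C (k + 1) x -
      B (N - 1 - k) x * chainQuotRev N A B C k x) / A (N - 1 - k) x

/-- The quotient `p_i / p_N` of terms of a Sturm chain, as a combination of the coefficients of the
chain. It makes sense at the common zeros of the chain as well. -/
def chainQuot (N : ℕ) (A B C : ℕ → ℝ → ℝ) (i : ℕ) : ℝ → ℝ :=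
  chainQuotRev N A B C (N + 1 - i)

variable {N : ℕ} {p A B C : ℕ → ℝ → ℝ} {c : ℝ}

lemma chainQuot_self (x : ℝ) : chainQuot N A B C N x = 1 := by
  simp [chainQuot, chainQuotRev]

lemma chainQuot_of_lt {i : ℕ} (hi : i < N) (x : ℝ) : chainQuot N A B C i x =
    (C i x * chainQuot N A B C (i + 1) x - B i x * chainQuot N A B C (i + 2) x) / A i x := by
  obtain ⟨k, rfl⟩ : ∃ k, N = i + k + 1 := ⟨N - i - 1, by omega⟩
  have e1 : i + k + 1 + 1 - i = k + 2 := by omega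
  have e2 : i + k + 1 + 1 - (i + 1) = k + 1 := by omega
  have e3 : i + k + 1 + 1 - (i + 2) = k := by omega
  have e4 : i + k + 1 - 1 - k = i := by omega
  simp only [chainQuot, e1, e2, e3, chainQuotRev, e4]

namespace IsSturmChainAt

lemma continuousAt_chainQuotRev (h : IsSturmChainAt N p A B C c) (k : ℕ) (hk : k ≤ N + 1) :
    ContinuousAt (chainQuotRev N A B C k) c := by
  induction k using Nat.twoStepInduction with
  | zero => exact continuousAt_const
  | one => exact continuousAt_const
  | more k ih1 ih2 =>
    have hlt : N - 1 - k < N := by omega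
    exact (((h.continuousAt_C _ hlt).mul (ih2 (by omega))).sub
      ((h.continuousAt_B _ hlt).mul (ih1 (by omega)))).div (h.continuousAt_A _ hlt)
      (h.A_pos _ hlt).ne'

lemma continuousAt_chainQuot (h : IsSturmChainAt N p A B C c) (i : ℕ) :
    ContinuousAt (chainQuot N A B C i) c :=
  h.continuousAt_chainQuotRev _ (by omega)

lemma eq_chainQuot_mul (h : IsSturmChainAt N p A B C c) (i : ℕ) (hi : i ≤ N + 1) :
    ∀ᶠ x in 𝓝 c, p i x = chainQuot N A B C i x * p N x := by
  obtain ⟨k, hk⟩ : ∃ k, i + k = N + 1 := ⟨N + 1 - i, by omega⟩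
  induction k using Nat.twoStepInduction generalizing i with
  | zero =>
    obtain rfl : i = N + 1 := by omega
    filter_upwards [h.last] with x hx
    simp [hx, chainQuot, chainQuotRev]
  | one =>
    obtain rfl : i = N := by omega
    exact Eventually.of_forall fun x => by rw [chainQuot_self, one_mul]
  | more k ih1 ih2 =>
    have hlt : i < N := by omega
    filter_upwards [ih1 (i + 2) (by omega) (by omega), ih2 (i + 1) (by omega) (by omega),
      h.relation i hlt, (h.continuousAt_A i hlt).eventually_const_lt (h.A_pos i hlt)]
      with x h1 h2 h3 h4
    rw [chainQuot_of_lt hlt, div_mul_eq_mul_div, eq_div_iff h4.ne']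
    rw [h1, h2] at h3
    linear_combination h3

/-- Two adjacent quotients have no common zero. -/
lemma chainQuot_ne_zero_or (h : IsSturmChainAt N p A B C c) (i : ℕ) (hi : i ≤ N)
    (h0 : chainQuot N A B C i c = 0) : chainQuot N A B C (i + 1) c ≠ 0 := by
  obtain ⟨k, hk⟩ : ∃ k, i + k = N := ⟨N - i, by omega⟩
  induction k generalizing i with
  | zero =>
    obtain rfl : i = N := by omega
    rw [chainQuot_self] at h0
    exact absurd h0 one_ne_zero
  | succ k ih =>
    have hlt : i < N := by omega
    intro h1
    have h2 := ih (i + 1) (by omega) h1 (by omega)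
    rw [chainQuot_of_lt hlt, h1, mul_zero, zero_sub, div_eq_zero_iff] at h0
    have := h0.resolve_right (h.A_pos i hlt).ne'
    rw [neg_eq_zero] at this
    exact (mul_ne_zero (h.B_pos i hlt).ne' h2) this

lemma sign_chainQuot_mul (h : IsSturmChainAt N p A B C c) (i : ℕ) (hi : i + 2 ≤ N)
    (h0 : chainQuot N A B C (i + 1) c = 0) :
    SignType.sign (chainQuot N A B C i c) * SignType.sign (chainQuot N A B C (i + 2) c) = -1 := by
  have hlt : i < N := by omega
  have h2 := h.chainQuot_ne_zero_or (i + 1) (by omega) h0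
  rw [← sign_mul, sign_eq_neg_one_iff, chainQuot_of_lt hlt, h0, mul_zero, zero_sub,
    div_mul_eq_mul_div]
  refine div_neg_of_neg_of_pos ?_ (h.A_pos i hlt)
  have := mul_pos (h.B_pos i hlt) (mul_self_pos.2 h2)
  nlinarith

lemma eventually_sign_chainQuot (h : IsSturmChainAt N p A B C c) :
    ∀ᶠ x in 𝓝[≠] c, ∀ i ∈ Finset.range (N + 1), chainQuot N A B C i c ≠ 0 →
      SignType.sign (chainQuot N A B C i x) = SignType.sign (chainQuot N A B C i c) := by
  rw [Filter.eventually_all_finset]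
  intro i _
  refine nhdsWithin_le_nhds (a := c) ?_
  change ∀ᶠ x in 𝓝 c, _
  by_cases hi : chainQuot N A B C i c = 0
  · exact Eventually.of_forall fun x hx => absurd hi hx
  · rcases lt_or_gt_of_ne hi with hi | hi
    · filter_upwards [(h.continuousAt_chainQuot i).eventually_lt_const hi] with x hx _
      rw [sign_neg hx, sign_neg hi]
    · filter_upwards [(h.continuousAt_chainQuot i).eventually_const_lt hi] with x hx _
      rw [sign_pos hx, sign_pos hi]

lemma eventually_signVarAt_eq (h : IsSturmChainAt N p A B C c)
    (hN : ∀ᶠ x in 𝓝[≠] c, p N x ≠ 0) :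
    ∀ᶠ x in 𝓝[≠] c, signVarAt N p x =
      signVar ((List.range (N + 1)).map fun i => SignType.sign (chainQuot N A B C i x)) := by
  have hall : ∀ᶠ x in 𝓝[≠] c, ∀ i ∈ Finset.range (N + 1),
      p i x = chainQuot N A B C i x * p N x := by
    rw [Filter.eventually_all_finset]
    intro i hi
    exact nhdsWithin_le_nhds (h.eq_chainQuot_mul i (by have := Finset.mem_range.1 hi; omega))
  filter_upwards [hN, hall] with x hx hx'
  rw [← signVar_map_mul (sign_ne_zero.2 hx), signVarAt, List.map_map]
  congr 1
  refine List.map_congr_left fun i hi => ?_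
  rw [hx' i (by simpa using hi), sign_mul, mul_comm]
  rfl

/-- If the first quotient does not vanish, then the number of variations does not change. -/
lemma exists_signVarAt_eq (h : IsSturmChainAt N p A B C c)
    (hN : ∀ᶠ x in 𝓝[≠] c, p N x ≠ 0) (h0 : chainQuot N A B C 0 c ≠ 0) :
    ∃ v, ∀ᶠ x in 𝓝[≠] c, signVarAt N p x = v := by
  refine ⟨signVar ((List.range (N + 1)).map fun i => SignType.sign (chainQuot N A B C i c)), ?_⟩
  filter_upwards [h.eventually_signVarAt_eq hN, h.eventually_sign_chainQuot] with x h1 h2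
  rw [h1]
  refine signVar_eq_of_perturbation N _ _ (sign_ne_zero.2 h0)
    (sign_ne_zero.2 (by rw [chainQuot_self]; exact one_ne_zero)) (fun i hi hne => ?_)
    (fun i hi hz => h.sign_chainQuot_mul i hi (sign_eq_zero_iff.1 hz))
  exact h2 i (Finset.mem_range.2 (by omega)) (sign_ne_zero.1 hne)

/-- If the first quotient vanishes, then the change of the number of variations comes from the
first two terms of the chain. -/
lemma exists_signVarAt_eq_add (h : IsSturmChainAt N p A B C c)
    (hN : ∀ᶠ x in 𝓝[≠] c, p N x ≠ 0) (h0 : chainQuot N A B C 0 c = 0) :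
    ∃ v, ∀ᶠ x in 𝓝[≠] c, signVarAt N p x = (if p 0 x * p 1 x < 0 then 1 else 0) + v := by
  have h1 := h.chainQuot_ne_zero_or 0 (Nat.zero_le _) h0
  obtain _ | M := N
  · rw [chainQuot_self] at h0
    exact absurd h0 one_ne_zero
  refine ⟨signVar ((List.range (M + 1)).map
    fun i => SignType.sign (chainQuot (M + 1) A B C (i + 1) c)), ?_⟩
  filter_upwards [h.eventually_signVarAt_eq hN, h.eventually_sign_chainQuot, hN,
    nhdsWithin_le_nhds (h.eq_chainQuot_mul 0 (by omega)),
    nhdsWithin_le_nhds (h.eq_chainQuot_mul 1 (by omega))] with x e1 e2 e3 e4 e5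
  have hs1 := e2 1 (Finset.mem_range.2 (by omega)) h1
  have hs1' : SignType.sign (chainQuot (M + 1) A B C 1 x) ≠ 0 := by
    rw [hs1]; exact sign_ne_zero.2 h1
  have key := signVar_eq_of_perturbation M
    (fun i => SignType.sign (chainQuot (M + 1) A B C (i + 1) c))
    (fun i => SignType.sign (chainQuot (M + 1) A B C (i + 1) x)) (sign_ne_zero.2 h1)
    (sign_ne_zero.2 (by rw [chainQuot_self]; exact one_ne_zero))
    (fun i hi hne => e2 (i + 1) (Finset.mem_range.2 (by omega)) (sign_ne_zero.1 hne))
    (fun i hi hz => h.sign_chainQuot_mul (i + 1) (by omega) (sign_eq_zero_iff.1 hz))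
  rw [e1, ← key, map_range_succ, map_range_succ (fun i =>
    SignType.sign (chainQuot (M + 1) A B C (i + 1) x)), signVar_cons_of_ne_zero hs1', ← sign_mul]
  congr 1
  have hsq : 0 < p (M + 1) x * p (M + 1) x := mul_self_pos.2 e3
  have : chainQuot (M + 1) A B C 0 x * p (M + 1) x * (chainQuot (M + 1) A B C 1 x * p (M + 1) x) =
      chainQuot (M + 1) A B C 0 x * chainQuot (M + 1) A B C 1 x *
        (p (M + 1) x * p (M + 1) x) := by ring
  refine if_congr ?_ rfl rfl
  rw [sign_eq_neg_one_iff, e4, e5, this]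
  constructor
  · exact fun h => mul_neg_of_neg_of_pos h hsq
  · exact fun h => neg_of_mul_neg_left h hsq.le

/-- The jump of the number of variations at `c`. Here `p_0 = f` and `p_1 = T f' g + U f` with
`T > 0`. A zero of `f` at which `g ≠ 0` is a zero of `p_0 / p_N`, since `f'` has smaller order than
`f`, and the sign of `p_0 p_1` is that of `g f' / f` near `c`. A zero of `f` at which `g = 0` is no
zero of `p_0 / p_N`, since `f' g / f` is bounded near `c`. -/
lemma exists_jump (h : IsSturmChainAt N p A B C c) {f' g T U : ℝ → ℝ} {g' r : ℝ}
    (hT : ContinuousAt T c) (hTpos : 0 < T c) (hU : ContinuousAt U c) (hg : HasDerivAt g g' c)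
    (hp1 : ∀ᶠ x in 𝓝 c, p 1 x = T x * (f' x * g x) + U x * p 0 x)
    (hne : ∀ᶠ x in 𝓝[≠] c, p 0 x ≠ 0)
    (hlog : p 0 c = 0 → 0 < r ∧
      Tendsto (fun x => f' x * (x - c) / p 0 x) (𝓝[≠] c) (𝓝 r)) :
    ∃ vl vr : ℕ, (∀ᶠ x in 𝓝[<] c, signVarAt N p x = vl) ∧
      (∀ᶠ x in 𝓝[>] c, signVarAt N p x = vr) ∧
      (vl : ℤ) - vr = if p 0 c = 0 then (SignType.sign (g c) : ℤ) else 0 := by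
  have hlt : 𝓝[<] c ≤ 𝓝[≠] c := nhdsWithin_mono c fun x hx => ne_of_lt hx
  have hgt : 𝓝[>] c ≤ 𝓝[≠] c := nhdsWithin_mono c fun x hx => ne_of_gt hx
  have hq0 := h.eq_chainQuot_mul 0 (by omega)
  have hq1 := h.eq_chainQuot_mul 1 (by omega)
  have hN : ∀ᶠ x in 𝓝[≠] c, p N x ≠ 0 := by
    filter_upwards [hne, nhdsWithin_le_nhds hq0] with x h1 h2 h3
    rw [h3, mul_zero] at h2
    exact h1 h2
  have hconst : chainQuot N A B C 0 c ≠ 0 → ∃ vl vr : ℕ,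
      (∀ᶠ x in 𝓝[<] c, signVarAt N p x = vl) ∧ (∀ᶠ x in 𝓝[>] c, signVarAt N p x = vr) ∧
      (vl : ℤ) - vr = 0 := by
    intro h0
    obtain ⟨v, hv⟩ := h.exists_signVarAt_eq hN h0
    exact ⟨v, v, hlt hv, hgt hv, sub_self _⟩
  by_cases hfc : p 0 c = 0
  swap
  · rw [if_neg hfc]
    refine hconst fun h0 => hfc ?_
    rw [hq0.self_of_nhds, h0, zero_mul]
  rw [if_pos hfc]
  obtain ⟨hr, hlim⟩ := hlog hfc
  have hTt := hT.tendsto.mono_left (nhdsWithin_le_nhds (s := {c}ᶜ))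
  have hUt := hU.tendsto.mono_left (nhdsWithin_le_nhds (s := {c}ᶜ))
  have hgt' := hg.continuousAt.tendsto.mono_left (nhdsWithin_le_nhds (s := {c}ᶜ))
  have h0t := (h.continuousAt_chainQuot 0).tendsto.mono_left (nhdsWithin_le_nhds (s := {c}ᶜ))
  have h1t := (h.continuousAt_chainQuot 1).tendsto.mono_left (nhdsWithin_le_nhds (s := {c}ᶜ))
  have hxt : Tendsto (fun x : ℝ => x - c) (𝓝[≠] c) (𝓝 0) := by
    have : Tendsto (fun x : ℝ => x - c) (𝓝 c) (𝓝 (c - c)) := Continuous.tendsto (by fun_prop) c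
    rw [sub_self] at this
    exact this.mono_left nhdsWithin_le_nhds
  -- the quotient `p_1 / p_0` has at most a simple pole, with residue `T g r`
  have hpole : Tendsto (fun x => (x - c) * (p 1 x / p 0 x)) (𝓝[≠] c) (𝓝 (T c * g c * r)) := by
    have := ((hTt.mul hgt').mul hlim).add (hUt.mul hxt)
    rw [mul_zero, add_zero] at this
    refine this.congr' ?_
    filter_upwards [hne, nhdsWithin_le_nhds hp1] with x h1 h2
    rw [h2]
    field_simp
  have hquot : ∀ᶠ x in 𝓝[≠] c, chainQuot N A B C 1 x =
      chainQuot N A B C 0 x * (p 1 x / p 0 x) := by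
    filter_upwards [hne, hN, nhdsWithin_le_nhds hq0, nhdsWithin_le_nhds hq1] with x h1 h2 h3 h4
    rw [eq_comm, ← mul_div_assoc, div_eq_iff h1, h3, h4]
    ring
  rcases eq_or_ne (g c) 0 with hg0 | hg0
  · rw [hg0, sign_zero]
    refine hconst fun h0 => h.chainQuot_ne_zero_or 0 (Nat.zero_le _) h0 ?_
    have hslope : Tendsto (fun x => g x / (x - c)) (𝓝[≠] c) (𝓝 g') := by
      refine hg.tendsto_slope.congr fun x => ?_
      rw [slope_def_field, hg0, sub_zero]
    have hbdd : Tendsto (fun x => p 1 x / p 0 x) (𝓝[≠] c) (𝓝 (T c * (r * g') + U c)) := by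
      refine ((hTt.mul (hlim.mul hslope)).add hUt).congr' ?_
      filter_upwards [hne, nhdsWithin_le_nhds hp1, self_mem_nhdsWithin] with x h1 h2 h3
      have h4 : x - c ≠ 0 := sub_ne_zero.2 h3
      rw [h2]
      field_simp
    have := tendsto_nhds_unique h1t ((h0t.mul hbdd).congr' (hquot.mono fun _ h => h.symm))
    rw [zero_add, this, h0, zero_mul]
  · have h0 : chainQuot N A B C 0 c = 0 := by
      have h2 : Tendsto (fun x => (x - c) * chainQuot N A B C 1 x) (𝓝[≠] c)
          (𝓝 (chainQuot N A B C 0 c * (T c * g c * r))) := by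
        refine (h0t.mul hpole).congr' ?_
        filter_upwards [hquot] with x hx
        rw [hx]
        ring
      have := tendsto_nhds_unique h2 (hxt.mul h1t)
      rw [zero_mul] at this
      exact (mul_eq_zero.1 this).resolve_right (mul_ne_zero (mul_ne_zero hTpos.ne' hg0) hr.ne')
    obtain ⟨v, hv⟩ := h.exists_signVarAt_eq_add hN h0
    have hprod : ∀ x, p 0 x ≠ 0 → p 0 x * p 1 x = p 0 x ^ 2 * (p 1 x / p 0 x) := by
      intro x hx
      field_simp
    rcases lt_or_gt_of_ne hg0 with hg0 | hg0
    · have hneg : T c * g c * r < 0 := mul_neg_of_neg_of_pos (mul_neg_of_pos_of_neg hTpos hg0) hr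
      refine ⟨v, 1 + v, ?_, ?_, by rw [sign_neg hg0]; push_cast; simp⟩
      · filter_upwards [hlt hv, hlt hne, hlt (hpole.eventually_lt_const hneg),
          self_mem_nhdsWithin] with x e1 e2 e3 e4
        have hx : x - c < 0 := sub_neg.2 e4
        have : 0 < p 1 x / p 0 x := pos_of_mul_neg_right e3 hx.le
        rw [e1, if_neg, zero_add]
        rw [hprod x e2, not_lt]
        positivity
      · filter_upwards [hgt hv, hgt hne, hgt (hpole.eventually_lt_const hneg),
          self_mem_nhdsWithin] with x e1 e2 e3 e4
        have hx : 0 < x - c := sub_pos.2 e4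
        have : p 1 x / p 0 x < 0 := neg_of_mul_neg_right e3 hx.le
        rw [e1, if_pos]
        rw [hprod x e2]
        exact mul_neg_of_pos_of_neg (by positivity) this
    · have hpos : 0 < T c * g c * r := by positivity
      refine ⟨1 + v, v, ?_, ?_, by rw [sign_pos hg0]; push_cast; simp⟩
      · filter_upwards [hlt hv, hlt hne, hlt (hpole.eventually_const_lt hpos),
          self_mem_nhdsWithin] with x e1 e2 e3 e4
        have hx : x - c < 0 := sub_neg.2 e4
        have : p 1 x / p 0 x < 0 := neg_of_mul_pos_right e3 hx.le
        rw [e1, if_pos]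
        rw [hprod x e2]
        exact mul_neg_of_pos_of_neg (by positivity) this
      · filter_upwards [hgt hv, hgt hne, hgt (hpole.eventually_const_lt hpos),
          self_mem_nhdsWithin] with x e1 e2 e3 e4
        have hx : 0 < x - c := sub_pos.2 e4
        have : 0 < p 1 x / p 0 x := pos_of_mul_pos_right e3 hx.le
        rw [e1, if_neg, zero_add]
        rw [hprod x e2, not_lt]
        positivity

end IsSturmChainAt

end SturmChain

/-! ### Sign variations on an interval -/

section Interval

lemma eventually_sign_eq_eventualSign {l : Filter ℝ} [l.NeBot] {θ : ℝ → ℝ}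
    (h : (∀ᶠ x in l, 0 < θ x) ∨ (∀ᶠ x in l, θ x < 0) ∨ ∀ᶠ x in l, θ x = 0) :
    ∀ᶠ x in l, SignType.sign (θ x) = eventualSign l θ := by
  rcases h with h | h | h
  · filter_upwards [h] with x hx
    rw [eventualSign, if_pos h, sign_pos hx]
  · have h1 : ¬ ∀ᶠ x in l, 0 < θ x := fun h' => by
      obtain ⟨x, hx1, hx2⟩ := (h.and h').exists
      exact lt_asymm hx1 hx2
    filter_upwards [h] with x hx
    rw [eventualSign, if_neg h1, if_pos h, sign_neg hx]
  · have h1 : ¬ ∀ᶠ x in l, 0 < θ x := fun h' => by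
      obtain ⟨x, hx1, hx2⟩ := (h.and h').exists
      exact hx2.ne' hx1
    have h2 : ¬ ∀ᶠ x in l, θ x < 0 := fun h' => by
      obtain ⟨x, hx1, hx2⟩ := (h.and h').exists
      exact hx2.ne hx1
    filter_upwards [h] with x hx
    rw [eventualSign, if_neg h1, if_neg h2, hx, sign_zero]

lemma eventually_signVarAt_eq_signVar {l : Filter ℝ} [l.NeBot] {N : ℕ} {p : ℕ → ℝ → ℝ}
    (h : ∀ i ≤ N, (∀ᶠ x in l, 0 < p i x) ∨ (∀ᶠ x in l, p i x < 0) ∨ ∀ᶠ x in l, p i x = 0) :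
    ∀ᶠ x in l, signVarAt N p x =
      signVar ((List.range (N + 1)).map fun i => eventualSign l (p i)) := by
  have hall : ∀ᶠ x in l, ∀ i ∈ Finset.range (N + 1),
      SignType.sign (p i x) = eventualSign l (p i) := by
    rw [Filter.eventually_all_finset]
    exact fun i hi => eventually_sign_eq_eventualSign (h i (by simpa [Nat.lt_succ_iff] using hi))
  filter_upwards [hall] with x hx
  rw [signVarAt]
  congr 1
  exact List.map_congr_left fun i hi => hx i (by simpa using hi)

lemma sign_eq_of_ne_zero {a b : ℝ} {θ : ℝ → ℝ} (hθ : ContinuousOn θ (Ioo a b))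
    (h0 : ∀ x ∈ Ioo a b, θ x ≠ 0) {x y : ℝ} (hx : x ∈ Ioo a b) (hy : y ∈ Ioo a b) :
    SignType.sign (θ x) = SignType.sign (θ y) := by
  have key : ∀ {x y : ℝ}, x ∈ Ioo a b → y ∈ Ioo a b → θ x < 0 → ¬ 0 < θ y := by
    intro x y hx hy h1 h2
    obtain ⟨z, hz, hz0⟩ := isPreconnected_Ioo.intermediate_value hx hy hθ ⟨h1.le, h2.le⟩
    exact h0 z hz hz0
  rcases lt_or_gt_of_ne (h0 x hx) with h1 | h1 <;> rcases lt_or_gt_of_ne (h0 y hy) with h2 | h2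
  · rw [sign_neg h1, sign_neg h2]
  · exact absurd h2 (key hx hy h1)
  · exact absurd h1 (key hy hx h2)
  · rw [sign_pos h1, sign_pos h2]

lemma signOn_eq_sign {a b : ℝ} {θ : ℝ → ℝ} (hθ : ContinuousOn θ (Ioo a b))
    (h0 : ∀ x ∈ Ioo a b, θ x ≠ 0) {x : ℝ} (hx : x ∈ Ioo a b) :
    signOn a b θ = SignType.sign (θ x) := by
  rcases lt_or_gt_of_ne (h0 x hx) with h | h
  · rw [signOn, if_neg fun h' => lt_asymm h (h' x hx), if_pos, sign_neg h]
    intro y hy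
    have := sign_eq_of_ne_zero hθ h0 hx hy
    rw [sign_neg h] at this
    exact sign_eq_neg_one_iff.1 this.symm
  · rw [signOn, if_pos, sign_pos h]
    intro y hy
    have := sign_eq_of_ne_zero hθ h0 hx hy
    rw [sign_pos h] at this
    exact sign_eq_one_iff.1 this.symm

lemma sum_filter_Ioo_split (Z : Finset ℝ) (J : ℝ → ℤ) {a b c : ℝ} (hac : a < c) (hcb : c < b)
    (hJ : c ∉ Z → J c = 0) :
    ∑ x ∈ Z with x ∈ Ioo a b, J x =
      ∑ x ∈ Z with x ∈ Ioo a c, J x + J c + ∑ x ∈ Z with x ∈ Ioo c b, J x := by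
  have hc : J c = ∑ x ∈ Z, if x = c then J x else 0 := by
    rw [Finset.sum_ite_eq']
    split_ifs with h
    · rfl
    · exact hJ h
  rw [hc, Finset.sum_filter, Finset.sum_filter, Finset.sum_filter, ← Finset.sum_add_distrib,
    ← Finset.sum_add_distrib]
  refine Finset.sum_congr rfl fun x _ => ?_
  rcases lt_trichotomy x c with h | rfl | h
  · have h1 : x ∉ Ioo c b := fun h' => lt_asymm h h'.1
    have h2 : x ∈ Ioo a b ↔ x ∈ Ioo a c := ⟨fun h' => ⟨h'.1, h⟩, fun h' => ⟨h'.1, h.trans hcb⟩⟩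
    simp only [h1, h2, h.ne, if_false, add_zero]
  · simp [hac, hcb]
  · have h1 : x ∉ Ioo a c := fun h' => lt_asymm h h'.2
    have h2 : x ∈ Ioo a b ↔ x ∈ Ioo c b := ⟨fun h' => ⟨h, h'.2⟩, fun h' => ⟨hac.trans h, h'.2⟩⟩
    simp only [h1, h2, h.ne', if_false, zero_add]

/-- The decrease of the number of sign variations over an interval is the sum of the jumps. -/
lemma signVarAt_sub_eq_sum {N : ℕ} {p : ℕ → ℝ → ℝ} {a b : ℝ} (Z : Finset ℝ) (J : ℝ → ℤ)
    (hcont : ∀ i ≤ N, ContinuousOn (p i) (Ioo a b))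
    (hZ : ∀ i ≤ N, (∀ x ∈ Ioo a b, p i x = 0) ∨ ∀ x ∈ Ioo a b, p i x = 0 → x ∈ Z)
    (hjump : ∀ c ∈ Ioo a b, ∃ vl vr : ℕ, (∀ᶠ x in 𝓝[<] c, signVarAt N p x = vl) ∧
      (∀ᶠ x in 𝓝[>] c, signVarAt N p x = vr) ∧ (vl : ℤ) - vr = J c) (n : ℕ) :
    ∀ a' b' : ℝ, a ≤ a' → a' < b' → b' ≤ b → (Z.filter (· ∈ Ioo a' b')).card ≤ n →
      ∀ v v' : ℕ, (∀ᶠ x in 𝓝[>] a', signVarAt N p x = v) →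
        (∀ᶠ x in 𝓝[<] b', signVarAt N p x = v') →
        (v : ℤ) - v' = ∑ x ∈ Z with x ∈ Ioo a' b', J x := by
  induction n with
  | zero =>
    intro a' b' ha hab hb hcard v v' hv hv'
    have hsub : Ioo a' b' ⊆ Ioo a b := Ioo_subset_Ioo ha hb
    have hempty : Z.filter (· ∈ Ioo a' b') = ∅ := Finset.card_eq_zero.1 (Nat.le_zero.1 hcard)
    obtain ⟨x, hx, hxv⟩ := ((eventually_mem_set.2 (Ioo_mem_nhdsGT hab)).and hv).exists
    obtain ⟨y, hy, hyv⟩ := ((eventually_mem_set.2 (Ioo_mem_nhdsLT hab)).and hv').exists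
    have hxy : signVarAt N p x = signVarAt N p y := by
      rw [signVarAt, signVarAt]
      congr 1
      refine List.map_congr_left fun i hi => ?_
      have hi' : i ≤ N := by simpa [Nat.lt_succ_iff] using hi
      rcases hZ i hi' with h | h
      · rw [h x (hsub hx), h y (hsub hy)]
      · refine sign_eq_of_ne_zero ((hcont i hi').mono hsub) (fun z hz hz0 => ?_) hx hy
        have : z ∈ Z.filter (· ∈ Ioo a' b') := Finset.mem_filter.2 ⟨h z (hsub hz) hz0, hz⟩
        rw [hempty] at this
        exact Finset.notMem_empty z this
    rw [hempty, Finset.sum_empty, ← hxv, ← hyv, hxy, sub_self]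
  | succ n ih =>
    intro a' b' ha hab hb hcard v v' hv hv'
    rcases (Z.filter (· ∈ Ioo a' b')).eq_empty_or_nonempty with hempty | ⟨c, hc⟩
    · exact ih a' b' ha hab hb (by rw [hempty]; simp) v v' hv hv'
    · obtain ⟨hcZ, hcI⟩ := Finset.mem_filter.1 hc
      obtain ⟨vl, vr, hl, hr, hj⟩ := hjump c ⟨ha.trans_lt hcI.1, hcI.2.trans_le hb⟩
      have hlt : ∀ s t : ℝ, Ioo s t ⊆ Ioo a' b' → c ∉ Ioo s t →
          (Z.filter (· ∈ Ioo s t)).card ≤ n := by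
        intro s t hs hcs
        refine Nat.le_of_lt_succ (lt_of_lt_of_le (Finset.card_lt_card ?_) hcard)
        refine (Finset.ssubset_iff_of_subset ?_).2 ⟨c, hc, fun h => hcs (Finset.mem_filter.1 h).2⟩
        exact fun x hx => Finset.mem_filter.2
          ⟨(Finset.mem_filter.1 hx).1, hs (Finset.mem_filter.1 hx).2⟩
      have h1 := ih a' c ha hcI.1 (hcI.2.le.trans hb)
        (hlt _ _ (Ioo_subset_Ioo le_rfl hcI.2.le) (by simp)) v vl hv hl
      have h2 := ih c b' (ha.trans hcI.1.le) hcI.2 hb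
        (hlt _ _ (Ioo_subset_Ioo hcI.1.le le_rfl) (by simp)) vr v' hr hv'
      rw [sum_filter_Ioo_split Z J hcI.1 hcI.2 fun h => absurd hcZ h]
      linarith

/-- The weight with which a point contributes to the Tarski query of `f` for `g`. -/
def queryWeight (f g : ℝ → ℝ) (x : ℝ) : ℤ :=
  if f x = 0 then (SignType.sign (g x) : ℤ) else 0

lemma ncard_sub_ncard_eq_sum {ι : Type*} (S : Finset ι) (a : ι → ℝ) (f g : ℝ → ℝ) :
    ({x | x ∈ S ∧ f (a x) = 0 ∧ 0 < g (a x)}.ncard : ℤ) -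
      ({x | x ∈ S ∧ f (a x) = 0 ∧ g (a x) < 0}.ncard : ℤ) = ∑ x ∈ S, queryWeight f g (a x) := by
  classical
  have h1 : {x | x ∈ S ∧ f (a x) = 0 ∧ 0 < g (a x)} =
      ↑(S.filter fun x => f (a x) = 0 ∧ 0 < g (a x)) := by ext; simp
  have h2 : {x | x ∈ S ∧ f (a x) = 0 ∧ g (a x) < 0} =
      ↑(S.filter fun x => f (a x) = 0 ∧ g (a x) < 0) := by ext; simp
  rw [h1, h2, Set.ncard_coe_finset, Set.ncard_coe_finset, Finset.card_filter, Finset.card_filter]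
  push_cast
  rw [← Finset.sum_sub_distrib]
  refine Finset.sum_congr rfl fun x _ => ?_
  by_cases hf : f (a x) = 0
  · rcases lt_trichotomy (g (a x)) 0 with h | h | h
    · simp [queryWeight, hf, h, h.not_gt, sign_neg h]
    · simp [queryWeight, hf, h]
    · simp [queryWeight, hf, h, h.not_gt, sign_pos h]
  · simp [queryWeight, hf]

lemma tarskiQuery_eq_sum (f g : ℝ → ℝ) {α β : ℝ} (Z : Finset ℝ)
    (hZ : ∀ x ∈ Ioo α β, f x = 0 → x ∈ Z) :
    tarskiQuery f g α β = ∑ x ∈ Z with x ∈ Ioo α β, queryWeight f g x := by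
  rw [← ncard_sub_ncard_eq_sum _ (fun x => x), tarskiQuery]
  congr 3 <;>
  · ext x
    simp only [mem_ofPred_eq, Finset.mem_filter]
    constructor
    · exact fun h => ⟨⟨hZ x h.1 h.2.1, h.1⟩, h.2⟩
    · exact fun h => ⟨h.1.2, h.2⟩

/-- A sum over the points of `Z` in an interval, split at the points of a subdivision. -/
lemma sum_filter_Ioo_subdivision (Z : Finset ℝ) (J : ℝ → ℤ) (a : ℕ → ℝ) (k : ℕ)
    (ha : StrictMonoOn a (Icc 0 (k + 1))) (hJ : ∀ j ∈ Icc 1 k, a j ∉ Z → J (a j) = 0) :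
    ∑ x ∈ Z with x ∈ Ioo (a 0) (a (k + 1)), J x = ∑ j ∈ Finset.Icc 1 k, J (a j) +
      ∑ j ∈ Finset.range (k + 1), ∑ x ∈ Z with x ∈ Ioo (a j) (a (j + 1)), J x := by
  induction k with
  | zero => simp
  | succ k ih =>
    have hlt : ∀ i j : ℕ, i < j → j ≤ k + 1 + 1 → a i < a j := fun i j hij hj =>
      ha ⟨Nat.zero_le _, by omega⟩ ⟨Nat.zero_le _, hj⟩ hij
    rw [sum_filter_Ioo_split Z J (hlt 0 (k + 1) (by omega) (by omega))
      (hlt (k + 1) (k + 1 + 1) (by omega) le_rfl) (hJ (k + 1) ⟨by omega, le_rfl⟩),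
      ih (ha.mono (Icc_subset_Icc le_rfl (by omega)))
        (fun j hj => hJ j ⟨hj.1, hj.2.trans (by omega)⟩), Finset.sum_range_succ _ (k + 1),
      Finset.sum_Icc_succ_top (by omega)]
    ring

end Interval

/-! ### The subresultant sequence of a Pfaffian function -/

section Degrees

/-- The leading terms cannot cancel: if `deg Φ = 1`, the coefficient of `Y^q` is
`τ' + q τ c` with `τ = lc F` and `c = lc Φ`, and `τ'` has smaller degree than `τ c`. -/
lemma coeff_tildePoly_ne_zero {Φ F : ℤ[X][Y]} (hΦ : 0 < Φ.natDegree) (hF : 0 < F.natDegree) :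
    (tildePoly Φ F).coeff (F.natDegree - 1 + Φ.natDegree) ≠ 0 := by
  have hF0 : F.leadingCoeff ≠ 0 := leadingCoeff_ne_zero.2 (by rintro rfl; simp at hF)
  have hΦ0 : Φ.leadingCoeff ≠ 0 := leadingCoeff_ne_zero.2 (by rintro rfl; simp at hΦ)
  have hmul : (derivative F * Φ).coeff (F.natDegree - 1 + Φ.natDegree) =
      F.leadingCoeff * (F.natDegree : ℤ[X]) * Φ.leadingCoeff := by
    rw [coeff_mul_add_eq_of_natDegree_le (natDegree_derivative_le F) le_rfl, coeff_derivative]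
    have : F.natDegree - 1 + 1 = F.natDegree := by omega
    rw [this, coeff_natDegree, coeff_natDegree, ← Nat.cast_succ, Nat.succ_eq_add_one, this]
  have hq : (F.natDegree : ℤ[X]) ≠ 0 := by exact_mod_cast hF.ne'
  have hne : F.leadingCoeff * (F.natDegree : ℤ[X]) * Φ.leadingCoeff ≠ 0 :=
    mul_ne_zero (mul_ne_zero hF0 hq) hΦ0
  rw [tildePoly, coeff_add, hmul, coeff_partialX]
  rcases (show 1 ≤ Φ.natDegree from hΦ).eq_or_lt with h1 | h1
  · rw [← h1, show F.natDegree - 1 + 1 = F.natDegree by omega, coeff_natDegree]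
    intro h
    have hd : derivative F.leadingCoeff = -(F.leadingCoeff * (F.natDegree : ℤ[X]) *
        Φ.leadingCoeff) := eq_neg_of_add_eq_zero_left h
    have h2 := degree_derivative_lt hF0
    rw [hd, degree_neg, mul_assoc, degree_mul] at h2
    have h3 : 0 ≤ ((F.natDegree : ℤ[X]) * Φ.leadingCoeff).degree :=
      zero_le_degree_iff.2 (mul_ne_zero hq hΦ0)
    exact absurd h2 (not_lt.2 (le_add_of_nonneg_right h3))
  · rw [coeff_eq_zero_of_natDegree_lt (n := F.natDegree - 1 + Φ.natDegree) (by omega),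
      derivative_zero, zero_add]
    exact hne

lemma natDegree_lt_natDegree_tildePoly_mul {Φ F G : ℤ[X][Y]} (hΦ : 0 < Φ.natDegree)
    (hF : 0 < F.natDegree) (hG : 0 < G.natDegree) :
    F.natDegree < (tildePoly Φ F * G).natDegree := by
  have h := coeff_tildePoly_ne_zero hΦ hF
  have h1 := le_natDegree_of_ne_zero h
  have h0 : tildePoly Φ F ≠ 0 := by rintro h0; simp [h0] at h
  rw [natDegree_mul h0 (by rintro rfl; simp at hG)]
  omega

end Degrees

section Critical

variable {P Q : ℤ[X][Y]}

lemma finite_aeval_eq_zero {q : ℤ[X]} (hq : q ≠ 0) : {x : ℝ | aeval x q = 0}.Finite :=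
  (rootSet_finite q ℝ).subset fun _ hx => mem_rootSet.2 ⟨hq, hx⟩

lemma tau_ne_zero (hQ : Q ≠ 0) {i : ℕ} (hi : i ≤ lastIndex P Q) : tau P Q i ≠ 0 :=
  leadingCoeff_ne_zero.2 ((seqR_ne_zero_iff hQ).2 hi)

lemma rho_ne_zero (hQ : Q ≠ 0) (hPQ : Q.natDegree < P.natDegree) {i : ℕ} (h1 : 1 ≤ i)
    (hi : i ≤ lastIndex P Q + 1) : rho P Q i ≠ 0 := by
  obtain ⟨i, rfl⟩ : ∃ j, i = j + 1 := ⟨i - 1, by omega⟩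
  exact rho_succ_ne_zero_of_injective (IsFractionRing.injective ℤ[X] (FractionRing ℤ[X])) hQ hPQ
    ((seqR_ne_zero_iff hQ).2 (by omega))

lemma finite_criticalRoots (hQ : Q ≠ 0) (hPQ : Q.natDegree < P.natDegree) :
    (criticalRoots P Q).Finite := by
  have hP : P ≠ 0 := by rintro rfl; simp at hPQ
  refine ((finite_aeval_eq_zero (leadingCoeff_ne_zero.2 hP)).union
    (((Set.finite_Iic (lastIndex P Q)).biUnion fun i hi =>
      finite_aeval_eq_zero (tau_ne_zero (P := P) hQ hi)).union
    ((Set.finite_Icc 1 (lastIndex P Q + 1)).biUnion fun i hi =>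
      finite_aeval_eq_zero (rho_ne_zero hQ hPQ hi.1 hi.2)))).subset ?_
  rintro x (hx | ⟨i, hi, hx⟩ | ⟨i, h1, hi, hx⟩)
  · exact Or.inl hx
  · exact Or.inr (Or.inl (mem_biUnion (show i ∈ Iic (lastIndex P Q) from hi) hx))
  · exact Or.inr (Or.inr (mem_biUnion (show i ∈ Icc 1 (lastIndex P Q + 1) from ⟨h1, hi⟩) hx))

variable {a b : ℝ}

lemma aeval_tau_ne_zero (hcrit : ∀ x ∈ Ioo a b, x ∉ criticalRoots P Q) {x : ℝ}
    (hx : x ∈ Ioo a b) {i : ℕ} (hi : i ≤ lastIndex P Q) : aeval x (tau P Q i) ≠ 0 :=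
  fun h => hcrit x hx (Or.inr (Or.inl ⟨i, hi, h⟩))

lemma aeval_rho_ne_zero (hcrit : ∀ x ∈ Ioo a b, x ∉ criticalRoots P Q) {x : ℝ}
    (hx : x ∈ Ioo a b) {i : ℕ} (h1 : 1 ≤ i) (hi : i ≤ lastIndex P Q + 1) :
    aeval x (rho P Q i) ≠ 0 :=
  fun h => hcrit x hx (Or.inr (Or.inr ⟨i, h1, hi, h⟩))

lemma signOn_aeval {q : ℤ[X]} (hq : ∀ x ∈ Ioo a b, aeval x q ≠ 0) {x : ℝ} (hx : x ∈ Ioo a b) :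
    signOn a b (fun y => aeval y q) = SignType.sign (aeval x q) :=
  signOn_eq_sign q.continuous_aeval.continuousOn hq hx

lemma aeval_relation_coeff_ne_zero (hcrit : ∀ x ∈ Ioo a b, x ∉ criticalRoots P Q) {x : ℝ}
    (hx : x ∈ Ioo a b) {i : ℕ} (hi : i < lastIndex P Q) :
    aeval x (rho P Q (i + 2) * tau P Q (i + 1)) ≠ 0 ∧
      aeval x (rho P Q (i + 1) * tau P Q i) ≠ 0 := by
  rw [map_mul, map_mul]
  exact ⟨mul_ne_zero (aeval_rho_ne_zero hcrit hx (by omega) (by omega))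
      (aeval_tau_ne_zero hcrit hx (by omega)),
    mul_ne_zero (aeval_rho_ne_zero hcrit hx (by omega) (by omega))
      (aeval_tau_ne_zero hcrit hx (by omega))⟩

/-- The recursion for the signs, with the sign on the interval read off at one point. -/
lemma sigma_add_two (hcrit : ∀ x ∈ Ioo a b, x ∉ criticalRoots P Q) {x : ℝ}
    (hx : x ∈ Ioo a b) {i : ℕ} (hi : i < lastIndex P Q) :
    sigma P Q a b (i + 2) = SignType.sign (aeval x (rho P Q (i + 2) * tau P Q (i + 1)) *
      aeval x (rho P Q (i + 1) * tau P Q i)) * sigma P Q a b i := by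
  have h : ∀ y : ℝ, aeval y (rho P Q (i + 2) * tau P Q (i + 1) * rho P Q (i + 1) * tau P Q i) =
      aeval y (rho P Q (i + 2) * tau P Q (i + 1)) * aeval y (rho P Q (i + 1) * tau P Q i) := by
    intro y
    rw [← map_mul, ← mul_assoc]
  rw [sigma, signOn_aeval _ hx, h]
  intro y hy
  rw [h]
  exact mul_ne_zero (aeval_relation_coeff_ne_zero hcrit hy hi).1
    (aeval_relation_coeff_ne_zero hcrit hy hi).2

lemma sigma_ne_zero (hcrit : ∀ x ∈ Ioo a b, x ∉ criticalRoots P Q) (hab : a < b) (i : ℕ)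
    (hi : i ≤ lastIndex P Q + 1) : sigma P Q a b i ≠ 0 := by
  obtain ⟨x, hx⟩ := nonempty_Ioo.2 hab
  induction i using Nat.twoStepInduction with
  | zero => exact one_ne_zero
  | one =>
    rw [sigma, signOn_aeval (fun y hy => aeval_tau_ne_zero hcrit hy (Nat.zero_le _)) hx]
    exact mul_ne_zero (pow_ne_zero _ (by decide))
      (pow_ne_zero _ (sign_ne_zero.2 (aeval_tau_ne_zero hcrit hx (Nat.zero_le _))))
  | more i ih _ =>
    rw [sigma_add_two hcrit hx (by omega)]
    obtain ⟨h1, h2⟩ := aeval_relation_coeff_ne_zero hcrit hx (i := i) (by omega)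
    exact mul_ne_zero (sign_ne_zero.2 (mul_ne_zero h1 h2)) (ih (by omega))

lemma sigma_mul_self (hcrit : ∀ x ∈ Ioo a b, x ∉ criticalRoots P Q) (hab : a < b) (i : ℕ)
    (hi : i ≤ lastIndex P Q + 1) : (sigma P Q a b i : ℝ) * sigma P Q a b i = 1 := by
  have : ∀ s : SignType, s ≠ 0 → s * s = 1 := by decide
  rw [← SignType.coe_mul, this _ (sigma_ne_zero hcrit hab i hi), SignType.coe_one]

lemma coe_sigma_ne_zero (hcrit : ∀ x ∈ Ioo a b, x ∉ criticalRoots P Q) (hab : a < b) (i : ℕ)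
    (hi : i ≤ lastIndex P Q + 1) : (sigma P Q a b i : ℝ) ≠ 0 :=
  left_ne_zero_of_mul_eq_one (sigma_mul_self hcrit hab i hi)

variable {φ : ℝ → ℝ} {α β : ℝ} {Φ : ℤ[X][Y]}

lemma continuousAt_pfaff (hφ : ∀ x ∈ Icc α β, HasDerivWithinAt φ (pfaff φ Φ x) (Icc α β) x)
    (H : ℤ[X][Y]) {c : ℝ} (hc : c ∈ Ioo α β) : ContinuousAt (pfaff φ H) c :=
  (hasDerivAt_pfaff hφ H hc).continuousAt

/-- On an interval without critical roots the functions `p_i` form a generalized Sturm chain: with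
`u = ρ_{i+2} τ_{i+1}` and `w = ρ_{i+1} τ_i`, multiplication of the relation
`u R_i + w R_{i+2} ∈ (R_{i+1})` by `σ_i u` gives `u² p_i + |u w| p_{i+2} ∈ (p_{i+1})`. -/
lemma exists_isSturmChainAt (hφ : ∀ x ∈ Icc α β, HasDerivWithinAt φ (pfaff φ Φ x) (Icc α β) x)
    (hQ : Q ≠ 0) (hPQ : Q.natDegree < P.natDegree)
    (hcrit : ∀ x ∈ Ioo a b, x ∉ criticalRoots P Q) (hsub : Ioo a b ⊆ Ioo α β) {c : ℝ}
    (hc : c ∈ Ioo a b) :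
    ∃ A B C : ℕ → ℝ → ℝ, IsSturmChainAt (lastIndex P Q) (seqP φ P Q a b) A B C c := by
  have hab : a < b := hc.1.trans hc.2
  have hrel : ∀ i, i < lastIndex P Q → ∃ (m : ℕ) (S : ℤ[X][Y]), ∀ x : ℝ,
      aeval x (tau P Q (i + 1)) ^ m *
        (aeval x (rho P Q (i + 2) * tau P Q (i + 1)) * pfaff φ (seqR P Q i) x +
          aeval x (rho P Q (i + 1) * tau P Q i) * pfaff φ (seqR P Q (i + 2)) x) =
      pfaff φ S x * pfaff φ (seqR P Q (i + 1)) x := by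
    intro i hi
    obtain ⟨m, S, h⟩ := exists_seqR_relation_of_injective
      (IsFractionRing.injective ℤ[X] (FractionRing ℤ[X])) hQ hPQ
      ((seqR_ne_zero_iff (P := P) hQ).2 (show i + 1 ≤ lastIndex P Q by omega))
    refine ⟨m, S, fun x => ?_⟩
    have := congrArg (fun E => pfaff φ E x) h
    simp only [pfaff_mul, pfaff_add, pfaff_C] at this
    rw [map_pow] at this
    exact this
  choose! m S hS using hrel
  set u : ℕ → ℝ → ℝ := fun i x => aeval x (rho P Q (i + 2) * tau P Q (i + 1)) with hu
  set w : ℕ → ℝ → ℝ := fun i x => aeval x (rho P Q (i + 1) * tau P Q i) with hw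
  have hucont : ∀ i, Continuous (u i) := fun i => Polynomial.continuous_aeval _
  have hwcont : ∀ i, Continuous (w i) := fun i => Polynomial.continuous_aeval _
  have huw : ∀ i < lastIndex P Q, ∀ x ∈ Ioo a b, u i x ≠ 0 ∧ w i x ≠ 0 :=
    fun i hi x hx => aeval_relation_coeff_ne_zero hcrit hx hi
  refine ⟨fun i x => u i x ^ 2, fun i x => |u i x * w i x|,
    fun i x => u i x * sigma P Q a b i * sigma P Q a b (i + 1) * pfaff φ (S i) x /
      aeval x (tau P Q (i + 1)) ^ m i, ?_, ?_, ?_, ?_, ?_, ?_, ?_⟩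
  · exact fun i _ => ((hucont i).pow 2).continuousAt
  · exact fun i _ => ((hucont i).mul (hwcont i)).abs.continuousAt
  · intro i hi
    refine ContinuousAt.div ?_ ?_ (pow_ne_zero _ (aeval_tau_ne_zero hcrit hc (by omega)))
    · exact (((hucont i).mul_const _).mul_const _).continuousAt.mul
        (continuousAt_pfaff hφ _ (hsub hc))
    · exact ((Polynomial.continuous_aeval _).pow _).continuousAt
  · exact fun i hi => sq_pos_of_ne_zero (huw i hi c hc).1
  · exact fun i hi => abs_pos.2 (mul_ne_zero (huw i hi c hc).1 (huw i hi c hc).2)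
  · intro i hi
    filter_upwards [Ioo_mem_nhds hc.1 hc.2] with x hx
    have ht : aeval x (tau P Q (i + 1)) ^ m i ≠ 0 :=
      pow_ne_zero _ (aeval_tau_ne_zero hcrit hx (by omega))
    have h2 : |u i x * w i x| * (sigma P Q a b (i + 2) : ℝ) =
        u i x * w i x * sigma P Q a b i := by
      rw [sigma_add_two hcrit hx hi, SignType.coe_mul, ← mul_assoc, abs_mul_sign]
    have h1 := sigma_mul_self hcrit hab (i + 1) (by omega)
    have h3 := hS i hi x
    simp only [seqP]
    rw [div_mul_eq_mul_div, eq_div_iff ht]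
    change aeval x (tau P Q (i + 1)) ^ m i * (u i x * pfaff φ (seqR P Q i) x +
      w i x * pfaff φ (seqR P Q (i + 2)) x) = _ at h3
    linear_combination (pfaff φ (seqR P Q (i + 2)) x * aeval x (tau P Q (i + 1)) ^ m i) * h2 +
      (u i x * sigma P Q a b i) * h3 -
      (u i x * sigma P Q a b i * pfaff φ (S i) x * pfaff φ (seqR P Q (i + 1)) x) * h1
  · refine Eventually.of_forall fun x => ?_
    have : seqR P Q (lastIndex P Q + 1) = 0 := by
      by_contra h
      have := (seqR_ne_zero_iff hQ).1 h
      omega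
    rw [seqP, this, pfaff_zero, mul_zero]

lemma seqP_zero (x : ℝ) : seqP φ P Q a b 0 x = pfaff φ Q x := by
  simp [seqP, sigma, seqR]

/-- The first two terms of the chain: `p_1 = |τ_0|^δ P(x, φ(x)) + U p_0` with continuous `U`. -/
lemma exists_seqP_one (hφ : ∀ x ∈ Icc α β, HasDerivWithinAt φ (pfaff φ Φ x) (Icc α β) x)
    (hQ : Q ≠ 0) (hPQ : Q.natDegree < P.natDegree)
    (hcrit : ∀ x ∈ Ioo a b, x ∉ criticalRoots P Q) (hsub : Ioo a b ⊆ Ioo α β) {c : ℝ}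
    (hc : c ∈ Ioo a b) :
    ∃ T U : ℝ → ℝ, ContinuousAt T c ∧ 0 < T c ∧ ContinuousAt U c ∧
      ∀ᶠ x in 𝓝 c, seqP φ P Q a b 1 x = T x * pfaff φ P x + U x * seqP φ P Q a b 0 x := by
  obtain ⟨m, S, h⟩ := exists_seqR_one_relation_of_injective
    (IsFractionRing.injective ℤ[X] (FractionRing ℤ[X])) hQ hPQ
  set d := P.natDegree - Q.natDegree + 1 with hd
  set e := (d * (d + 1)) / 2 with he
  have hτ : ∀ x ∈ Ioo a b, aeval x (tau P Q 0) ≠ 0 := fun x hx =>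
    aeval_tau_ne_zero hcrit hx (Nat.zero_le _)
  have hτcont : Continuous fun x : ℝ => aeval x (tau P Q 0) := Polynomial.continuous_aeval _
  refine ⟨fun x => |aeval x (tau P Q 0)| ^ d, fun x => sigma P Q a b 1 * pfaff φ S x /
    aeval x (tau P Q 0) ^ m, (hτcont.abs.pow d).continuousAt, pow_pos (abs_pos.2 (hτ c hc)) d,
    ((continuousAt_pfaff hφ S (hsub hc)).const_mul _).div (hτcont.pow m).continuousAt
      (pow_ne_zero m (hτ c hc)), ?_⟩
  filter_upwards [Ioo_mem_nhds hc.1 hc.2] with x hx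
  have h1 := congrArg (fun E => pfaff φ E x) h
  simp only [pfaff_mul, pfaff_sub, pfaff_C] at h1
  rw [map_pow, map_mul, map_pow, map_pow, map_neg, map_one] at h1
  have hσ : (sigma P Q a b 1 : ℝ) * ((-1) ^ e * aeval x (tau P Q 0) ^ d) =
      |aeval x (tau P Q 0)| ^ d := by
    have hs : sigma P Q a b 1 = (-1) ^ e * SignType.sign (aeval x (tau P Q 0)) ^ d := by
      rw [sigma, signOn_aeval hτ hx]
    rw [hs, SignType.coe_mul, SignType.coe_pow, SignType.coe_pow, SignType.coe_neg,
      SignType.coe_one, mul_mul_mul_comm, ← mul_pow, ← mul_pow, sign_mul_self]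
    simp
  have ht : aeval x (tau P Q 0) ^ m ≠ 0 := pow_ne_zero m (hτ x hx)
  rw [seqP_zero, seqP, ← hσ]
  field_simp
  linear_combination (sigma P Q a b 1 : ℝ) * h1

end Critical

/-! ### Sturm's theorem between critical roots -/

section SturmInterval

variable {φ : ℝ → ℝ} {Φ F G : ℤ[X][Y]} {α β : ℝ}

lemma const_mul_eventually_sign {l : Filter ℝ} {θ : ℝ → ℝ} (s : SignType)
    (h : (∀ᶠ x in l, 0 < θ x) ∨ (∀ᶠ x in l, θ x < 0) ∨ ∀ᶠ x in l, θ x = 0) :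
    (∀ᶠ x in l, 0 < (s : ℝ) * θ x) ∨ (∀ᶠ x in l, (s : ℝ) * θ x < 0) ∨
      ∀ᶠ x in l, (s : ℝ) * θ x = 0 := by
  rcases s.trichotomy with rfl | rfl | rfl
  · rcases h with h | h | h
    · exact Or.inr (Or.inl (h.mono fun x hx => by simpa using hx))
    · exact Or.inl (h.mono fun x hx => by simpa using hx)
    · exact Or.inr (Or.inr (h.mono fun x hx => by simpa using hx))
  · exact Or.inr (Or.inr (Eventually.of_forall fun x => by simp))
  · simpa using h

lemma eventually_sign_seqP_right
    (hφ : ∀ x ∈ Icc α β, HasDerivWithinAt φ (pfaff φ Φ x) (Icc α β) x) (P Q : ℤ[X][Y])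
    (a b : ℝ) (i : ℕ) {c : ℝ} (hc : c ∈ Ico α β) :
    (∀ᶠ x in 𝓝[>] c, 0 < seqP φ P Q a b i x) ∨ (∀ᶠ x in 𝓝[>] c, seqP φ P Q a b i x < 0) ∨
      ∀ᶠ x in 𝓝[>] c, seqP φ P Q a b i x = 0 := by
  refine const_mul_eventually_sign (sigma P Q a b i) ?_
  by_cases h : ∃ x ∈ Icc α β, pfaff φ (seqR P Q i) x ≠ 0
  · exact (eventually_sign_right hφ h hc).imp_right Or.inl
  · push Not at h
    right; right
    filter_upwards [Ioo_mem_nhdsGT hc.2] with x hx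
    exact h x ⟨hc.1.trans hx.1.le, hx.2.le⟩

lemma eventually_sign_seqP_left
    (hφ : ∀ x ∈ Icc α β, HasDerivWithinAt φ (pfaff φ Φ x) (Icc α β) x) (P Q : ℤ[X][Y])
    (a b : ℝ) (i : ℕ) {c : ℝ} (hc : c ∈ Ioc α β) :
    (∀ᶠ x in 𝓝[<] c, 0 < seqP φ P Q a b i x) ∨ (∀ᶠ x in 𝓝[<] c, seqP φ P Q a b i x < 0) ∨
      ∀ᶠ x in 𝓝[<] c, seqP φ P Q a b i x = 0 := by
  refine const_mul_eventually_sign (sigma P Q a b i) ?_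
  by_cases h : ∃ x ∈ Icc α β, pfaff φ (seqR P Q i) x ≠ 0
  · exact (eventually_sign_left hφ h hc).imp_right Or.inl
  · push Not at h
    right; right
    filter_upwards [Ioo_mem_nhdsLT hc.1] with x hx
    exact h x ⟨hx.1.le, hx.2.le.trans hc.2⟩

/-- The points of `[α, β]` where some `R_i(x, φ(x))` that is not identically zero vanishes. -/
def chainZeros (φ : ℝ → ℝ) (P Q : ℤ[X][Y]) (α β : ℝ) : Set ℝ :=
  ⋃ i ∈ {i | i ≤ lastIndex P Q ∧ ∃ x ∈ Icc α β, pfaff φ (seqR P Q i) x ≠ 0},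
    {x | x ∈ Icc α β ∧ pfaff φ (seqR P Q i) x = 0}

lemma finite_chainZeros (hφ : ∀ x ∈ Icc α β, HasDerivWithinAt φ (pfaff φ Φ x) (Icc α β) x)
    (P Q : ℤ[X][Y]) : (chainZeros φ P Q α β).Finite :=
  ((Set.finite_Iic (lastIndex P Q)).subset fun _ hi => hi.1).biUnion
    fun _ hi => finite_zeros_pfaff hφ hi.2

/-- Sturm's theorem on an interval without critical roots. -/
theorem varRight_sub_varLeft
    (hφ : ∀ x ∈ Icc α β, HasDerivWithinAt φ (pfaff φ Φ x) (Icc α β) x)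
    (hF0 : F ≠ 0) (hdeg : F.natDegree < (tildePoly Φ F * G).natDegree)
    (hf : ∃ x ∈ Icc α β, pfaff φ F x ≠ 0) (Z : Finset ℝ)
    (hZ : chainZeros φ (tildePoly Φ F * G) F α β ⊆ Z) {a b : ℝ} (hαa : α ≤ a) (hab : a < b)
    (hbβ : b ≤ β) (hcrit : ∀ x ∈ Ioo a b, x ∉ criticalRoots (tildePoly Φ F * G) F) :
    (varRight (lastIndex (tildePoly Φ F * G) F) (seqP φ (tildePoly Φ F * G) F a b) a : ℤ) -
      (varLeft (lastIndex (tildePoly Φ F * G) F) (seqP φ (tildePoly Φ F * G) F a b) b : ℤ) =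
    ∑ x ∈ Z with x ∈ Ioo a b, queryWeight (pfaff φ F) (pfaff φ G) x := by
  set P := tildePoly Φ F * G with hP
  have hsub : Ioo a b ⊆ Ioo α β := Ioo_subset_Ioo hαa hbβ
  refine signVarAt_sub_eq_sum Z (queryWeight (pfaff φ F) (pfaff φ G)) (a := a) (b := b)
    ?_ ?_ ?_ _ a b le_rfl hab le_rfl le_rfl _ _
    (eventually_signVarAt_eq_signVar fun i _ =>
      eventually_sign_seqP_right hφ P F a b i ⟨hαa, hab.trans_le hbβ⟩)
    (eventually_signVarAt_eq_signVar fun i _ =>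
      eventually_sign_seqP_left hφ P F a b i ⟨hαa.trans_lt hab, hbβ⟩)
  · intro i _ x hx
    exact ((continuousAt_pfaff hφ _ (hsub hx)).const_mul _).continuousWithinAt
  · intro i hi
    by_cases h : ∃ x ∈ Icc α β, pfaff φ (seqR P F i) x ≠ 0
    · right
      intro x hx hx0
      refine hZ (mem_biUnion (x := i) ⟨hi, h⟩ ⟨Ioo_subset_Icc_self (hsub hx), ?_⟩)
      exact (mul_eq_zero.1 hx0).resolve_left (coe_sigma_ne_zero hcrit hab i (by omega))
    · left
      push Not at h
      intro x hx
      rw [seqP, h x (Ioo_subset_Icc_self (hsub hx)), mul_zero]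
  · intro c hc
    obtain ⟨A, B, C, hchain⟩ := exists_isSturmChainAt hφ hF0 hdeg hcrit hsub hc
    obtain ⟨T, U, hT, hTpos, hU, hp1⟩ := exists_seqP_one hφ hF0 hdeg hcrit hsub hc
    have hp0 : seqP φ P F a b 0 = pfaff φ F := funext fun x => seqP_zero x
    have hlog : ∃ r : ℝ, seqP φ P F a b 0 c = 0 → 0 < r ∧
        Tendsto (fun x => pfaff φ (tildePoly Φ F) x * (x - c) / seqP φ P F a b 0 x)
          (𝓝[≠] c) (𝓝 r) := by
      rw [hp0]
      by_cases h0 : pfaff φ F c = 0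
      · obtain ⟨r, hr⟩ := exists_tendsto_logDeriv hφ hf (hsub hc) h0
        exact ⟨r, fun _ => hr⟩
      · exact ⟨0, fun h => absurd h h0⟩
    obtain ⟨r, hr⟩ := hlog
    have := hchain.exists_jump hT hTpos hU (hasDerivAt_pfaff hφ G (hsub hc))
      (hp1.mono fun x hx => by rw [hx, hP, pfaff_mul])
      (by rw [hp0]; exact eventually_ne_zero hφ hf (hsub hc)) hr
    rwa [hp0] at this

end SturmInterval

end

end PfaffianSturm

open PfaffianSturm in
theorem mainTheorem5 (Φ F G : ℤ[X][Y]) (hΦ : 0 < Φ.natDegree) (hF : 0 < F.natDegree)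
    (hG : 0 < G.natDegree) (φ : ℝ → ℝ) (D : Set ℝ)
    (hφ : ∀ x ∈ D, HasDerivWithinAt φ (pfaff φ Φ x) D x)
    (α β : ℝ) (hαβ : α < β) (hD : Icc α β ⊆ D)
    (hf : ∃ x ∈ Ioo α β, pfaff φ F x ≠ 0) :
    {x | x ∈ Ioo α β ∧ pfaff φ F x = 0}.Finite ∧
    (criticalRoots (tildePoly Φ F * G) F ∩ Ioo α β).Finite ∧
    ∀ (k : ℕ) (a : ℕ → ℝ), a 0 = α → a (k + 1) = β → StrictMonoOn a (Icc 0 (k + 1)) →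
      a '' Icc 1 k = criticalRoots (tildePoly Φ F * G) F ∩ Ioo α β →
      tarskiQuery (pfaff φ F) (pfaff φ G) α β =
        ({j | j ∈ Icc 1 k ∧ pfaff φ F (a j) = 0 ∧ 0 < pfaff φ G (a j)}.ncard : ℤ) -
          ({j | j ∈ Icc 1 k ∧ pfaff φ F (a j) = 0 ∧ pfaff φ G (a j) < 0}.ncard : ℤ) +
        ∑ j ∈ Finset.range (k + 1),
          ((varRight (lastIndex (tildePoly Φ F * G) F)
              (seqP φ (tildePoly Φ F * G) F (a j) (a (j + 1))) (a j) : ℤ) -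
            (varLeft (lastIndex (tildePoly Φ F * G) F)
              (seqP φ (tildePoly Φ F * G) F (a j) (a (j + 1))) (a (j + 1)) : ℤ)) := by
  have hφ' : ∀ x ∈ Icc α β, HasDerivWithinAt φ (pfaff φ Φ x) (Icc α β) x :=
    fun x hx => (hφ x (hD hx)).mono hD
  have hf' : ∃ x ∈ Icc α β, pfaff φ F x ≠ 0 := by
    obtain ⟨x, hx, h⟩ := hf
    exact ⟨x, Ioo_subset_Icc_self hx, h⟩
  have hF0 : F ≠ 0 := by rintro rfl; simp at hF
  have hdeg := natDegree_lt_natDegree_tildePoly_mul hΦ hF hG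
  have hfin := finite_chainZeros hφ' (tildePoly Φ F * G) F
  refine ⟨(finite_zeros_pfaff hφ' hf').subset fun x hx => ⟨Ioo_subset_Icc_self hx.1, hx.2⟩,
    (finite_criticalRoots hF0 hdeg).inter_of_left _, fun k a ha0 hak hmono himg => ?_⟩
  set Z : Finset ℝ := hfin.toFinset with hZ
  have hZmem : ∀ x ∈ Icc α β, pfaff φ F x = 0 → x ∈ Z := by
    intro x hx h0
    rw [hZ, Set.Finite.mem_toFinset]
    exact mem_biUnion (x := 0) ⟨Nat.zero_le _, hf'⟩ ⟨hx, h0⟩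
  have hmem : ∀ j ≤ k + 1, a j ∈ Icc α β := by
    intro j hj
    rw [← ha0, ← hak]
    exact ⟨hmono.monotoneOn ⟨le_rfl, Nat.zero_le _⟩ ⟨Nat.zero_le _, hj⟩ (Nat.zero_le _),
      hmono.monotoneOn ⟨Nat.zero_le _, hj⟩ ⟨Nat.zero_le _, le_rfl⟩ hj⟩
  have hpts := ncard_sub_ncard_eq_sum (Finset.Icc 1 k) a (pfaff φ F) (pfaff φ G)
  simp only [Finset.mem_Icc] at hpts
  simp only [mem_Icc]
  rw [hpts, tarskiQuery_eq_sum _ _ Z fun x hx => hZmem x (Ioo_subset_Icc_self hx)]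
  have hsum := sum_filter_Ioo_subdivision Z (queryWeight (pfaff φ F) (pfaff φ G)) a k hmono
    fun j hj hj' => if_neg fun h0 => hj' (hZmem _ (hmem j (hj.2.trans (Nat.le_succ k))) h0)
  rw [ha0, hak] at hsum
  rw [hsum]
  congr 1
  refine Finset.sum_congr rfl fun j hj => ?_
  have hjk : j < k + 1 := Finset.mem_range.1 hj
  have hlt : a j < a (j + 1) :=
    hmono ⟨Nat.zero_le _, hjk.le⟩ ⟨Nat.zero_le _, hjk⟩ (Nat.lt_succ_self j)
  refine (varRight_sub_varLeft hφ' hF0 hdeg hf' Z (by rw [hZ, Set.Finite.coe_toFinset])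
    (hmem j hjk.le).1 hlt (hmem (j + 1) hjk).2 fun x hx hx' => ?_).symm
  -- a critical root between `a j` and `a (j + 1)` would be a further point of the subdivision
  have hxI : x ∈ Ioo α β := ⟨(hmem j hjk.le).1.trans_lt hx.1, hx.2.trans_le (hmem (j + 1) hjk).2⟩
  have : x ∈ a '' Icc 1 k := by
    rw [himg]
    exact ⟨hx', hxI⟩
  obtain ⟨i, hi, rfl⟩ := this
  have hi' : i ∈ Icc 0 (k + 1) := ⟨Nat.zero_le _, hi.2.trans (Nat.le_succ k)⟩
  have h1 : j < i := (hmono.lt_iff_lt ⟨Nat.zero_le _, hjk.le⟩ hi').1 hx.1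
  have h2 : i < j + 1 := (hmono.lt_iff_lt hi' ⟨Nat.zero_le _, hjk⟩).1 hx.2
  omega
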